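/- Let $c\in\mathbb R$, $\beta>0$ and let $h:[0,\beta]\to(0,\infty)$ be a smooth solution of $$2hh''+4h'^2-4+h^2(1+ch'^2)=0$$ with $h(0)=\sqrt6$, $h'(0)=0$, $h'<0$ on $(0,\beta)$, $h'(\beta)=0$ and $h(\beta)=\sqrt2$ (so $c$ is the constant $c_o\approx-0.5276$ of the Koiso–Cao soliton). Put $f=-hh'$. On $S^3\times(0,\beta)$ let $H=\partial/\partial t$, let $X,Y,Z$ be the $SU(2)$-left invariant vector fields on $S^3$ with $[X,Y]=2Z$, $[Y,Z]=2X$, $[Z,X]=2Y$, where $X$ is tangent to the Hopf circles, and let $g$ be the metric with orthonormal frame $H,\ X/f,\ Y/h,\ Z/h$. Let $\mathbf g$ be the extension of $g$ to $\mathbb{CP}^2\#\overline{\mathbb{CP}^2}$ (realized as the blow-up of $\mathbb{CP}^2$ at a point), which is obtained from $S^3\times[0,\beta]$ by collapsing the Hopf circles over $t=0$ and over $t=\beta$, with the smooth structure given by geodesic polar coordinates around the two singular orbits; $\mathbf g$ is the Koiso–Cao soliton. Then $\mathbf g$ is a smooth Riemannian metric and it has positive Ricci curvature: $\mathrm{Ric}_{\mathbf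 g}(a,a)>0$ for every nonzero tangent vector $a$ at every point of $\mathbb{CP}^2\#\overline{\mathbb{CP}^2}$. More precisely, on $S^3\times(0,\beta)$ $$\mathrm{Ric}(H,H)=\mathrm{Ric}\left(\tfrac Xf,\tfrac Xf\right)=1+c\,(hh''+h'^2),\qquad \mathrm{Ric}\left(\tfrac Yh,\tfrac Yh\right)=\mathrm{Ric}\left(\tfrac Zh,\tfrac Zh\right)=1+c\,h'^2,$$ and $1+c\,(hh''+h'^2)>0$ and $1+c\,h'^2>0$ on all of $[0,\beta]$. -/

import Mathlib

open scoped ContDiff Topology LinearAlgebra.Projectivization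

/-! ### Riemannian geometry in local coordinates on an open subset of `ℝ⁴` -/

/-- The partial derivative `∂ᵢ φ` at `x`. -/
noncomputable def partialD (i : Fin 4) (φ : (Fin 4 → ℝ) → ℝ) (x : Fin 4 → ℝ) : ℝ :=
  fderiv ℝ φ x (Pi.single i 1)

/-- The Christoffel symbol `Γᵏᵢⱼ = ½ ∑ₗ gᵏˡ (∂ᵢ gⱼₗ + ∂ⱼ gᵢₗ - ∂ₗ gᵢⱼ)` of a metric `g`. -/
noncomputable def christoffel (g : (Fin 4 → ℝ) → Matrix (Fin 4) (Fin 4) ℝ)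
    (k i j : Fin 4) (x : Fin 4 → ℝ) : ℝ :=
  (1 / 2) * ∑ l, (g x)⁻¹ k l *
    (partialD i (fun y => g y j l) x + partialD j (fun y => g y i l) x
      - partialD l (fun y => g y i j) x)

/-- The Ricci tensor
`Ricᵢⱼ = ∑ₖ (∂ₖ Γᵏᵢⱼ - ∂ⱼ Γᵏᵢₖ + ∑ₗ (Γᵏₖₗ Γˡᵢⱼ - Γᵏⱼₗ Γˡᵢₖ))` of the Levi-Civita connection. -/
noncomputable def ricciMatrix (g : (Fin 4 → ℝ) → Matrix (Fin 4) (Fin 4) ℝ)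
    (x : Fin 4 → ℝ) : Matrix (Fin 4) (Fin 4) ℝ :=
  Matrix.of fun i j => ∑ k,
    (partialD k (christoffel g k i j) x - partialD j (christoffel g k i k) x
      + ∑ l, (christoffel g k k l x * christoffel g l i j x
        - christoffel g k j l x * christoffel g l i k x))

/-- `Ric(a, b)` for tangent vectors `a`, `b` at `x` given by their coordinates. -/
noncomputable def ricci (g : (Fin 4 → ℝ) → Matrix (Fin 4) (Fin 4) ℝ)
    (x a b : Fin 4 → ℝ) : ℝ :=
  ∑ i, ∑ j, a i * ricciMatrix g x i j * b j

/-! ### The profile function -/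

/-- `h` is smooth and positive on `[0, β]`, solves
`2 h h'' + 4 h'² - 4 + h² (1 + c h'²) = 0`, and satisfies `h(0) = √6`, `h'(0) = 0`,
`h' < 0` on `(0, β)`, `h'(β) = 0`, `h(β) = √2`. The constant `c` is then the constant `c_o` of the
Koiso–Cao soliton. Derivatives are taken within `[0, β]` (one-sided at the ends). -/
structure IsKoisoCaoProfile (c β : ℝ) (h : ℝ → ℝ) : Prop where
  beta_pos : 0 < β
  smooth : ContDiffOn ℝ ∞ h (Set.Icc 0 β)
  pos : ∀ t ∈ Set.Icc 0 β, 0 < h t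
  ode : ∀ t ∈ Set.Icc 0 β,
    2 * h t * iteratedDerivWithin 2 h (Set.Icc 0 β) t
      + 4 * derivWithin h (Set.Icc 0 β) t ^ 2 - 4
      + h t ^ 2 * (1 + c * derivWithin h (Set.Icc 0 β) t ^ 2) = 0
  left_val : h 0 = √6
  left_deriv : derivWithin h (Set.Icc 0 β) 0 = 0
  deriv_neg : ∀ t ∈ Set.Ioo 0 β, derivWithin h (Set.Icc 0 β) t < 0
  right_deriv : derivWithin h (Set.Icc 0 β) β = 0
  right_val : h β = √2

/-- The function `f = - h h'`, which makes the metric Kähler. -/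
noncomputable def profileF (β : ℝ) (h : ℝ → ℝ) (t : ℝ) : ℝ :=
  -(h t * derivWithin h (Set.Icc 0 β) t)

/-! ### The metric on `S³ × (0, β)`

`S³` is the unit sphere of `ℂ²`, identified with `SU(2)` through
`(v, w) ↦ !![v, -w̄; w, v̄]`. -/

/-- The unit sphere `S³` of `ℂ²`. -/
def S3 : Set (Fin 2 → ℂ) := {v | Complex.normSq (v 0) + Complex.normSq (v 1) = 1}

/-- The left invariant field of `diag(i, -i)`; its orbits are the Hopf circles. -/
noncomputable def fieldX (v : Fin 2 → ℂ) : Fin 2 → ℂ := ![Complex.I * v 0, Complex.I * v 1]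

/-- The left invariant field of `!![0, 1; -1, 0]`. -/
noncomputable def fieldY (v : Fin 2 → ℂ) : Fin 2 → ℂ := ![star (v 1), -star (v 0)]

/-- The left invariant field of `!![0, i; i, 0]`. With this choice
`[X, Y] = 2 Z`, `[Y, Z] = 2 X`, `[Z, X] = 2 Y`. -/
noncomputable def fieldZ (v : Fin 2 → ℂ) : Fin 2 → ℂ :=
  ![-(Complex.I * star (v 1)), Complex.I * star (v 0)]

/-- The standard Euclidean inner product of `ℂ² = ℝ⁴`. At points of `S³` the vectors `X, Y, Z` are
orthonormal for it, so `u ↦ realInner (X v) u`, … is the dual coframe of `X, Y, Z`. -/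
noncomputable def realInner (u v : Fin 2 → ℂ) : ℝ := ∑ k, (star (u k) * v k).re

/-- The metric `g = dt² + g_t` on `S³ × (0, β)` at the point `q = (v, t)`, evaluated on tangent
vectors `a`, `b`: the metric for which `∂/∂t, X/f, Y/h, Z/h` is an orthonormal frame. -/
noncomputable def cohomOneMetric (β : ℝ) (h : ℝ → ℝ) (q a b : (Fin 2 → ℂ) × ℝ) : ℝ :=
  a.2 * b.2
    + profileF β h q.2 ^ 2 * (realInner (fieldX q.1) a.1 * realInner (fieldX q.1) b.1)
    + h q.2 ^ 2 * (realInner (fieldY q.1) a.1 * realInner (fieldY q.1) b.1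
      + realInner (fieldZ q.1) a.1 * realInner (fieldZ q.1) b.1)

/-! ### The compact manifold: the blow-up of `ℂP²` at `[1 : 0 : 0]` -/

/-- `ℂP² # (-ℂP²)`, as the blow-up of `ℂP²` at `[1 : 0 : 0]`: the pairs
`([a₀ : a₁ : a₂], [b₀ : b₁])` with `a₁ b₁ = a₂ b₀`. -/
def BlowUpCP2 : Type :=
  {p : ℙ ℂ (Fin 3 → ℂ) × ℙ ℂ (Fin 2 → ℂ) // p.1.rep 1 * p.2.rep 1 = p.1.rep 2 * p.2.rep 0}

theorem S3.ne_zero {v : Fin 2 → ℂ} (hv : v ∈ S3) : v ≠ 0 := by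
  rintro rfl
  simp [S3] at hv

theorem collapse_ne_zero (θ : ℝ) {v : Fin 2 → ℂ} (hv : v ∈ S3) :
    ![(Real.sin θ : ℂ), Real.cos θ * v 0, Real.cos θ * v 1] ≠ 0 := by
  intro h0
  have e0' : (Real.sin θ : ℂ) = 0 := congrFun h0 0
  have e0 : Real.sin θ = 0 := by exact_mod_cast e0'
  have e1 : Real.cos θ = 0 ∨ v 0 = 0 := by
    have := congrFun h0 1
    simp only [Matrix.cons_val_one, Matrix.cons_val_zero, Pi.zero_apply, mul_eq_zero] at this
    exact_mod_cast this
  have e2 : Real.cos θ = 0 ∨ v 1 = 0 := by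
    have := congrFun h0 2
    simp only [Matrix.cons_val, Pi.zero_apply, mul_eq_zero] at this
    exact_mod_cast this
  have e3 := Real.sin_sq_add_cos_sq θ
  rcases e1 with e1 | e1
  · simp [e0, e1] at e3
  · rcases e2 with e2 | e2
    · simp [e0, e2] at e3
    · simp [S3, e1, e2] at hv

/-- The map `S³ × [0, β] → ℂP² # (-ℂP²)`,
`(v, t) ↦ ([sin (π t / 2β) : cos (π t / 2β) v], [v])`. It identifies `S³ × (0, β)` with the union of
the regular orbits of `U(2)`, and collapses the Hopf circles over `t = 0` (onto the line at
infinity `a₀ = 0`) and over `t = β` (onto the exceptional divisor); these are the two singular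
orbits. -/
noncomputable def collapse (β : ℝ) (q : S3 × ℝ) : BlowUpCP2 :=
  ⟨(Projectivization.mk ℂ _ (collapse_ne_zero (Real.pi * q.2 / (2 * β)) q.1.2),
    Projectivization.mk ℂ q.1.1 (S3.ne_zero q.1.2)), by
    obtain ⟨a, ha⟩ := Projectivization.exists_smul_eq_mk_rep ℂ _
      (collapse_ne_zero (Real.pi * q.2 / (2 * β)) q.1.2)
    obtain ⟨b, hb⟩ := Projectivization.exists_smul_eq_mk_rep ℂ q.1.1 (S3.ne_zero q.1.2)
    simp only [← ha, ← hb, Pi.smul_apply, Units.smul_def, smul_eq_mul, Matrix.cons_val]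
    ring⟩

/-! ### Coordinates

There are four charts, indexed by the affine chart `i` of the base `ℂP¹` (coordinate `z`, standing
for `[1 : z]` if `i = 0` and for `[z : 1]` if `i = 1`) and the end `e` of `[0, β]`. The fibre
coordinate `w` is the polar coordinate around the singular orbit `t = 0` (if `e = 0`) or `t = β`
(if `e = 1`): `|w|` is the distance `t`, respectively `β - t`, to that orbit, and the argument of `w`
is the phase of `v` along the Hopf circle. -/

noncomputable def coordZ (x : Fin 4 → ℝ) : ℂ := ⟨x 0, x 1⟩

noncomputable def coordW (x : Fin 4 → ℝ) : ℂ := ⟨x 2, x 3⟩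

/-- `w / |w|`, with the value `1` at `w = 0`. -/
noncomputable def phase (w : ℂ) : ℂ := if w = 0 then 1 else w / ‖w‖

/-- The coordinate domain `|w| < β`. -/
def chartDomain (β : ℝ) : Set (Fin 4 → ℝ) := {x | ‖coordW x‖ < β}

/-- The part `w ≠ 0` of the coordinate space, which parametrizes regular orbits. -/
def offCore : Set (Fin 4 → ℝ) := {x | coordW x ≠ 0}

/-- The point `(v, t)` of `S³ × [0, β]` with coordinates `x`. -/
noncomputable def chartLift (β : ℝ) (i e : Fin 2) (x : Fin 4 → ℝ) : (Fin 2 → ℂ) × ℝ :=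
  ((phase (coordW x) / √(1 + Complex.normSq (coordZ x)) : ℂ) •
      (if i = 0 then ![1, coordZ x] else ![coordZ x, 1]),
    if e = 0 then ‖coordW x‖ else β - ‖coordW x‖)

theorem norm_phase (w : ℂ) : ‖phase w‖ = 1 := by
  unfold phase
  split_ifs with hw
  · simp
  · simp [hw]

theorem chartLift_mem (β : ℝ) (i e : Fin 2) (x : Fin 4 → ℝ) : (chartLift β i e x).1 ∈ S3 := by
  have hp : Complex.normSq (phase (coordW x)) = 1 := by
    rw [Complex.normSq_eq_norm_sq, norm_phase]; norm_num
  have hn : 0 < 1 + Complex.normSq (coordZ x) := by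
    have := Complex.normSq_nonneg (coordZ x); linarith
  have hs : √(1 + Complex.normSq (coordZ x)) * √(1 + Complex.normSq (coordZ x))
      = 1 + Complex.normSq (coordZ x) := Real.mul_self_sqrt hn.le
  by_cases hi : i = 0 <;>
    simp [chartLift, S3, hi, hp, Complex.normSq_mul, hs] <;>
    field_simp
  ring

/-- The parametrization of `ℂP² # (-ℂP²)` by the coordinates. -/
noncomputable def chartParam (β : ℝ) (i e : Fin 2) (x : Fin 4 → ℝ) : BlowUpCP2 :=
  collapse β (⟨(chartLift β i e x).1, chartLift_mem β i e x⟩, (chartLift β i e x).2)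

theorem collapse_inj {β : ℝ} (hβ : 0 < β) {q q' : S3 × ℝ} (hq : q.2 ∈ Set.Icc 0 β)
    (hq' : q'.2 ∈ Set.Icc 0 β) (hc : collapse β q = collapse β q') :
    q.2 = q'.2 ∧ (∃ μ : ℂ, μ • q'.1.1 = q.1.1) ∧ (q.2 ∈ Set.Ioo 0 β → q.1 = q'.1) := by
  have hpi := Real.pi_pos
  obtain ⟨⟨v, hv⟩, t⟩ := q
  obtain ⟨⟨v', hv'⟩, t'⟩ := q'
  simp only at hq hq'
  have h1 := congrArg (fun p : BlowUpCP2 => p.1.1) hc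
  have h2 := congrArg (fun p : BlowUpCP2 => p.1.2) hc
  simp only [collapse] at h1 h2
  rw [Projectivization.mk_eq_mk_iff'] at h1 h2
  obtain ⟨κ, hκ⟩ := h1
  have rng : ∀ s ∈ Set.Icc 0 β, Real.pi * s / (2 * β) ∈ Set.Icc 0 (Real.pi / 2) := by
    intro s hs
    constructor
    · have := hs.1; positivity
    · rw [div_le_div_iff₀ (by positivity) (by norm_num)]
      nlinarith [mul_le_mul_of_nonneg_left hs.2 hpi.le]
  have r := rng t hq
  have r' := rng t' hq'
  set θ := Real.pi * t / (2 * β) with hθ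
  set θ' := Real.pi * t' / (2 * β) with hθ'
  have k0 : κ * (Real.sin θ' : ℂ) = (Real.sin θ : ℂ) := congrFun hκ 0
  have k1 : κ * ((Real.cos θ' : ℂ) * v' 0) = (Real.cos θ : ℂ) * v 0 := congrFun hκ 1
  have k2 : κ * ((Real.cos θ' : ℂ) * v' 1) = (Real.cos θ : ℂ) * v 1 := congrFun hκ 2
  have n0 := congrArg Complex.normSq k0
  have n1 := congrArg Complex.normSq k1
  have n2 := congrArg Complex.normSq k2
  simp only [Complex.normSq_mul, Complex.normSq_ofReal] at n0 n1 n2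
  simp only [S3, Set.mem_ofPred_eq] at hv hv'
  have s1 := Real.sin_sq_add_cos_sq θ
  have s2 := Real.sin_sq_add_cos_sq θ'
  have kk : Complex.normSq κ = 1 := by
    have e1 : Complex.normSq κ * (Real.cos θ' * Real.cos θ')
        = Real.cos θ * Real.cos θ := by
      linear_combination n1 + n2 + Real.cos θ * Real.cos θ * hv
        - Complex.normSq κ * (Real.cos θ' * Real.cos θ') * hv'
    linear_combination n0 + e1 + s1 - Complex.normSq κ * s2
  have sn : 0 ≤ Real.sin θ := Real.sin_nonneg_of_nonneg_of_le_pi r.1 (by linarith [r.2])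
  have sn' : 0 ≤ Real.sin θ' := Real.sin_nonneg_of_nonneg_of_le_pi r'.1 (by linarith [r'.2])
  have se : Real.sin θ' = Real.sin θ := by
    rw [kk, one_mul] at n0
    exact (mul_self_inj sn' sn).1 n0
  have te : θ' = θ := Real.injOn_sin ⟨by linarith [r'.1], r'.2⟩ ⟨by linarith [r.1], r.2⟩ se
  have tt : t = t' := by
    rw [hθ, hθ', div_left_inj' (by positivity)] at te
    exact (mul_left_cancel₀ hpi.ne' te).symm
  refine ⟨tt, h2, fun ht => ?_⟩
  have p1 : 0 < θ := by have := ht.1; simp only at this; positivity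
  have p2 : θ < Real.pi / 2 := by
    have h3 : t < β := ht.2
    rw [hθ, div_lt_div_iff₀ (by positivity) (by norm_num)]
    nlinarith [mul_lt_mul_of_pos_left h3 hpi]
  have sp : (Real.sin θ : ℂ) ≠ 0 := by
    exact_mod_cast (Real.sin_pos_of_pos_of_lt_pi p1 (by linarith)).ne'
  have cp : (Real.cos θ : ℂ) ≠ 0 := by
    exact_mod_cast (Real.cos_pos_of_mem_Ioo ⟨by linarith, p2⟩).ne'
  rw [te] at k0 k1 k2
  have κ1 : κ = 1 := mul_right_cancel₀ sp (by rw [k0, one_mul])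
  rw [κ1, one_mul] at k1 k2
  apply Subtype.ext
  ext j
  fin_cases j
  · exact (mul_left_cancel₀ cp k1).symm
  · exact (mul_left_cancel₀ cp k2).symm

/-- Each coordinate system is injective on its domain. -/
theorem chartParam_injOn {β : ℝ} (hβ : 0 < β) (i e : Fin 2) :
    Set.InjOn (chartParam β i e) (chartDomain β) := by
  intro x hx y hy hxy
  simp only [chartDomain, Set.mem_ofPred_eq] at hx hy
  have mem : ∀ u : Fin 4 → ℝ, ‖coordW u‖ < β → (chartLift β i e u).2 ∈ Set.Icc 0 β := by
    intro u hu
    have := norm_nonneg (coordW u)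
    simp only [chartLift]
    split_ifs <;> constructor <;> linarith
  obtain ⟨h1, ⟨μ, h2⟩, h3⟩ := collapse_inj hβ (mem x hx) (mem y hy) hxy
  have hw : ‖coordW x‖ = ‖coordW y‖ := by
    simp only [chartLift] at h1
    split_ifs at h1 <;> linarith
  have pne : ∀ w : ℂ, phase w ≠ 0 := fun w h => by have := norm_phase w; simp [h] at this
  have sne : ∀ z : ℂ, (√(1 + Complex.normSq z) : ℂ) ≠ 0 := fun z => by
    have := Complex.normSq_nonneg z
    have h4 : 0 < √(1 + Complex.normSq z) := Real.sqrt_pos.2 (by linarith)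
    exact_mod_cast h4.ne'
  have ax := div_ne_zero (pne (coordW x)) (sne (coordZ x))
  have ay := div_ne_zero (pne (coordW y)) (sne (coordZ y))
  have hz : coordZ x = coordZ y := by
    have c0 := congrFun h2 0
    have c1 := congrFun h2 1
    by_cases hi : i = 0
    · simp only [chartLift, hi, if_true, Pi.smul_apply, smul_eq_mul, Matrix.cons_val_zero,
        Matrix.cons_val_one, mul_one] at c0 c1
      rw [← mul_assoc, c0] at c1
      exact (mul_left_cancel₀ ax c1).symm
    · simp only [chartLift, hi, if_false, Pi.smul_apply, smul_eq_mul, Matrix.cons_val_zero,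
        Matrix.cons_val_one, mul_one] at c0 c1
      rw [← mul_assoc, c1] at c0
      exact (mul_left_cancel₀ ax c0).symm
  have hww : coordW x = coordW y := by
    by_cases h0 : coordW x = 0
    · rw [h0, norm_zero] at hw
      rw [h0, norm_eq_zero.1 hw.symm]
    · have np : 0 < ‖coordW x‖ := norm_pos_iff.2 h0
      have h0' : coordW y ≠ 0 := norm_pos_iff.1 (hw ▸ np)
      have h4 := congrArg Subtype.val (h3 (by
        simp only [chartLift]; split_ifs <;> constructor <;> linarith))
      have h5 : phase (coordW x) = phase (coordW y) := by
        by_cases hi : i = 0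
        · have c0 := congrFun h4 0
          simp only [chartLift, hi, if_true, Pi.smul_apply, smul_eq_mul, Matrix.cons_val_zero,
            mul_one, hz] at c0
          exact (div_left_inj' (sne _)).1 c0
        · have c0 := congrFun h4 1
          simp only [chartLift, hi, if_false, Pi.smul_apply, smul_eq_mul, Matrix.cons_val_one,
            hz] at c0
          have c0' : phase (coordW x) / (√(1 + Complex.normSq (coordZ y)) : ℂ) * 1
              = phase (coordW y) / (√(1 + Complex.normSq (coordZ y)) : ℂ) * 1 := c0
          rw [mul_one, mul_one] at c0'
          exact (div_left_inj' (sne _)).1 c0'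
      simp only [phase, h0, h0', if_false, hw] at h5
      have : (‖coordW y‖ : ℂ) ≠ 0 := by exact_mod_cast (hw ▸ np).ne'
      exact (div_left_inj' this).1 h5
  have z0 := congrArg Complex.re hz
  have z1 := congrArg Complex.im hz
  have w0 := congrArg Complex.re hww
  have w1 := congrArg Complex.im hww
  ext j
  fin_cases j
  exacts [z0, z1, w0, w1]

/-- The four coordinate domains cover `ℂP² # (-ℂP²)`. -/
theorem exists_chartParam_eq {β : ℝ} (hβ : 0 < β) (p : BlowUpCP2) :
    ∃ i e, ∃ x ∈ chartDomain β, chartParam β i e x = p := by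
  have hpi := Real.pi_pos
  obtain ⟨⟨ℓ, m⟩, hp⟩ := p
  simp only at hp
  have ha := ℓ.rep_nonzero
  have hb := m.rep_nonzero
  set a := ℓ.rep with hadef
  set b := m.rep with hbdef
  -- the affine chart of the base
  obtain ⟨i, z, r, l, hbz, haz1, haz2⟩ : ∃ (i : Fin 2) (z r l : ℂ),
      b = r • (if i = 0 then ![1, z] else ![z, 1]) ∧
      a 1 = l * (if i = 0 then ![1, z] else ![z, 1] : Fin 2 → ℂ) 0 ∧
      a 2 = l * (if i = 0 then ![1, z] else ![z, 1] : Fin 2 → ℂ) 1 := by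
    by_cases h0 : b 0 = 0
    · have h1 : b 1 ≠ 0 := by
        intro h1; apply hb; ext j; fin_cases j <;> assumption
      refine ⟨1, 0, b 1, a 2, ?_, ?_, ?_⟩
      · ext j; fin_cases j <;> simp [h0]
      · simpa [h0, h1] using hp
      · simp
    · refine ⟨0, b 1 / b 0, b 0, a 1, ?_, ?_, ?_⟩
      · ext j; fin_cases j <;> simp [h0, mul_div_cancel₀]
      · simp
      · simp only [if_true, Matrix.cons_val_one]
        change a 2 = a 1 * (b 1 / b 0)
        rw [mul_div_assoc', hp, mul_div_cancel_right₀ _ h0]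
  have hr : r ≠ 0 := by rintro rfl; exact hb (by simpa using hbz)
  set u : Fin 2 → ℂ := if i = 0 then ![1, z] else ![z, 1] with hu
  set n : ℝ := √(1 + Complex.normSq z) with hn
  have npos : 0 < n := Real.sqrt_pos.2 (by have := Complex.normSq_nonneg z; linarith)
  have nne : (n : ℂ) ≠ 0 := by exact_mod_cast npos.ne'
  -- the fibre coordinate
  obtain ⟨e, w, κ, hw, hκ, k0, k1⟩ : ∃ (e : Fin 2) (w κ : ℂ), ‖w‖ < β ∧ κ ≠ 0 ∧
      (κ * Real.sin (Real.pi * (if e = 0 then ‖w‖ else β - ‖w‖) / (2 * β)) = a 0) ∧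
      (κ * (Real.cos (Real.pi * (if e = 0 then ‖w‖ else β - ‖w‖) / (2 * β)) * phase w)
        = l * n) := by
    by_cases hl : l = 0
    · have h0 : a 0 ≠ 0 := by
        intro h0; apply ha; ext j
        fin_cases j
        · exact h0
        · simpa [hl] using haz1
        · simpa [hl] using haz2
      have h4 : Real.pi * β / (2 * β) = Real.pi / 2 := by field_simp
      exact ⟨1, 0, a 0, by simpa using hβ, h0, by simp [h4], by simp [h4, hl]⟩
    · have lp : 0 < ‖l‖ * n := mul_pos (norm_pos_iff.2 hl) npos
      set s : ℝ := ‖a 0‖ / (‖l‖ * n) with hs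
      have s0 : 0 ≤ s := by positivity
      have at0 : 0 ≤ Real.arctan s := Real.arctan_nonneg.2 s0
      have at1 := Real.arctan_lt_pi_div_two s
      have cpos := Real.cos_arctan_pos s
      have hsin : Real.sin (Real.arctan s) = s * Real.cos (Real.arctan s) := by
        conv_rhs => rw [← Real.tan_arctan s]
        rw [Real.tan_arctan s]
        conv_lhs => rw [← Real.tan_mul_cos cpos.ne', Real.tan_arctan]
      have ccne : (Real.cos (Real.arctan s) : ℂ) ≠ 0 := by exact_mod_cast cpos.ne'
      have lne : (‖l‖ : ℂ) ≠ 0 := by exact_mod_cast (norm_pos_iff.2 hl).ne'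
      by_cases h0 : a 0 = 0
      · refine ⟨0, 0, l * n, by simpa using hβ, mul_ne_zero hl nne, by simp [h0], by simp [phase]⟩
      · have a0p : 0 < ‖a 0‖ := norm_pos_iff.2 h0
        have a0ne : (‖a 0‖ : ℂ) ≠ 0 := by exact_mod_cast a0p.ne'
        have spos : 0 < s := by positivity
        have atp : 0 < Real.arctan s := Real.arctan_pos.2 spos
        set t : ℝ := 2 * β / Real.pi * Real.arctan s with ht
        have tp : 0 < t := by positivity
        have tpne : (t : ℂ) ≠ 0 := by exact_mod_cast tp.ne'
        set ρ : ℂ := (l / ‖l‖) / (a 0 / ‖a 0‖) with hρ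
        have nρ : ‖ρ‖ = 1 := by
          simp [hρ, hl, h0]
        have nw : ‖(t : ℂ) * ρ‖ = t := by
          rw [norm_mul, nρ, mul_one, Complex.norm_real, Real.norm_of_nonneg tp.le]
        have ph : phase (t * ρ) = ρ := by
          have : (t : ℂ) * ρ ≠ 0 := by
            rw [← norm_pos_iff, nw]; exact tp
          rw [phase, if_neg this, nw, mul_div_assoc, mul_div_cancel₀]
          exact tpne
        have hθ : Real.pi * t / (2 * β) = Real.arctan s := by
          rw [ht]; field_simp
        refine ⟨0, t * ρ, (a 0 / ‖a 0‖) * (‖l‖ * n) / Real.cos (Real.arctan s), ?_, ?_, ?_, ?_⟩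
        · rw [nw, ht, div_mul_eq_mul_div, div_lt_iff₀ hpi]
          nlinarith
        · exact div_ne_zero (mul_ne_zero (div_ne_zero h0 a0ne) (mul_ne_zero lne nne)) ccne
        · rw [if_pos rfl, nw, hθ, hsin, Complex.ofReal_mul, div_mul_eq_mul_div, ← mul_assoc,
            mul_div_assoc, div_self ccne, mul_one, hs]
          push_cast
          field_simp
        · rw [if_pos rfl, nw, hθ, ph, hρ]
          field_simp
  refine ⟨i, e, ![z.re, z.im, w.re, w.im], ?_, ?_⟩
  · simpa [chartDomain, coordW] using hw
  · have cz : coordZ ![z.re, z.im, w.re, w.im] = z := rfl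
    have cw : coordW ![z.re, z.im, w.re, w.im] = w := rfl
    have pne : phase w ≠ 0 := fun h => by have := norm_phase w; simp [h] at this
    apply Subtype.ext
    simp only [chartParam, collapse, chartLift, cz, cw, ← hu, ← hn]
    refine Prod.ext ?_ ?_
    · rw [← ℓ.mk_rep, Projectivization.mk_eq_mk_iff']
      refine ⟨κ⁻¹, ?_⟩
      rw [inv_smul_eq_iff₀ hκ, ← hadef]
      ext j
      fin_cases j
      · exact k0.symm
      · change a 1 = κ * (_ * (phase w / n * u 0))
        rw [haz1]
        have : l = κ * (Real.cos (Real.pi * (if e = 0 then ‖w‖ else β - ‖w‖) / (2 * β))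
          * phase w) / n := by rw [k1]; field_simp
        rw [this]; ring
      · change a 2 = κ * (_ * (phase w / n * u 1))
        rw [haz2]
        have : l = κ * (Real.cos (Real.pi * (if e = 0 then ‖w‖ else β - ‖w‖) / (2 * β))
          * phase w) / n := by rw [k1]; field_simp
        rw [this]; ring
    · rw [← m.mk_rep, Projectivization.mk_eq_mk_iff']
      refine ⟨phase w / n / r, ?_⟩
      rw [← hbdef, hbz, smul_smul, div_mul_cancel₀ _ hr]

/-! ### The Koiso–Cao metric -/

/-- The coordinate matrix of the metric of `S³ × (0, β)`, i.e. its pullback under `chartLift`;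
meaningful for `w ≠ 0`. -/
noncomputable def regularMetric (β : ℝ) (h : ℝ → ℝ) (i e : Fin 2) (x : Fin 4 → ℝ) :
    Matrix (Fin 4) (Fin 4) ℝ :=
  Matrix.of fun k l => cohomOneMetric β h (chartLift β i e x)
    (fderiv ℝ (chartLift β i e) x (Pi.single k 1)) (fderiv ℝ (chartLift β i e) x (Pi.single l 1))

/-- The coordinate matrix, in the chart `(i, e)`, of the metric on `ℂP² # (-ℂP²)`: the metric of
`S³ × (0, β)` extended by continuity to the singular orbit `w = 0`. -/
noncomputable def koisoCaoMetric (β : ℝ) (h : ℝ → ℝ) (i e : Fin 2) :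
    (Fin 4 → ℝ) → Matrix (Fin 4) (Fin 4) ℝ :=
  extendFrom offCore (regularMetric β h i e)

/-- `1 + c (h h'' + h'²)` as a function of `t ∈ [0, β]`. -/
noncomputable def ricH (c β : ℝ) (h : ℝ → ℝ) (t : ℝ) : ℝ :=
  1 + c * (h t * iteratedDerivWithin 2 h (Set.Icc 0 β) t + derivWithin h (Set.Icc 0 β) t ^ 2)

/-- `1 + c h'²` as a function of `t ∈ [0, β]`. -/
noncomputable def ricY (c β : ℝ) (h : ℝ → ℝ) (t : ℝ) : ℝ :=
  1 + c * derivWithin h (Set.Icc 0 β) t ^ 2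

/-!
The metric is `dr² + f² (dθ + A)² + u² |dz|² / (1 + |z|²)²` in each of the four charts, where `z` is
an affine coordinate of `ℂP¹`, `w = r e^{iθ}` is the polar coordinate around a singular orbit, `u` is
the profile `h` as a function of the distance `r` to that orbit, `f = ∓ u u'`, and
`A = Im (z̄ dz) / (1 + |z|²)` is the connection form of the Hopf fibration. This is computed from the
differential of `chartLift` in `fderiv_chartLift`; the affine chart of `ℂP¹` plays no role.

*Smoothness.* The profile equation is regular where `h > 0` and invariant under `t ↦ -t`, so that
`h'(0) = h'(β) = 0` makes the even reflection of `h` at either end a solution again, hence smooth by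
bootstrapping (`IsKoisoCaoProfile.isEvenProfile`, `IsEvenProfile.contDiffOn`). With `F = (f / r)²` and
`E = (F - 1) / r²` the metric takes the form `smoothMetric`, whose coefficients are polynomials in the
coordinates, `1 / (1 + |z|²)`, and the functions `E, F, u` of `|w|`. The equation gives `F(0) = 1`
when `h² ∈ {6, 2}`, so that `E` and `F` are even and smooth by Hadamard's lemma
(`contDiffOn_dslope_zero`), and smooth even functions of the norm are smooth
(`contDiffOn_comp_norm`).

*Curvature.* Cartan's structure equations for the orthonormal coframe
`dr, f (dθ + A), u dx / (1 + |z|²), u dy / (1 + |z|²)`, with `z = x + i y`, give the Levi-Civita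
connection and its curvature (`IsEvenProfile.torsion`, `IsEvenProfile.curvature`). That these compute
the coordinate expression of the Ricci tensor is the change of frame in `mul_christoffelMatrix` and
`mul_curvatureMatrix`. Once the profile equation has eliminated the second and third derivatives
of `u`, the Ricci tensor is diagonal in this coframe with the eigenvalues `ricH` and `ricY`
(`IsEvenProfile.ricciMatrix_smoothMetric`).

*Positivity.* In the variable `s = h²` the quantity `p = h'²` satisfies a linear equation, which
integrates to `∫ s (4 - s) exp (c s / 2) ds = 0` over `[2, 6]`. The integral is negative for `c ≥ 0`
and positive for `c ≤ -1`, so `-1 < c < 0`. A comparison argument then gives `f² = s p ≤ s - 2`, and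
with it `ricH, ricY ≥ 1 + c > 0`. Hence `Ric ≥ (1 + c) g` on the regular part, and on the singular
orbits by continuity (`IsKoisoCaoProfile.one_add_mul_le_ricci`).
-/

/-! ### Partial derivatives -/

theorem partialD_congr {φ ψ : (Fin 4 → ℝ) → ℝ} {x : Fin 4 → ℝ} (h : φ =ᶠ[𝓝 x] ψ) (i : Fin 4) :
    partialD i φ x = partialD i ψ x := by
  simp only [partialD, h.fderiv_eq]

theorem partialD_add {φ ψ : (Fin 4 → ℝ) → ℝ} {x : Fin 4 → ℝ} (hφ : DifferentiableAt ℝ φ x)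
    (hψ : DifferentiableAt ℝ ψ x) (i : Fin 4) :
    partialD i (fun y => φ y + ψ y) x = partialD i φ x + partialD i ψ x := by
  simp only [partialD, fderiv_fun_add hφ hψ, add_apply]

theorem partialD_sum {ι : Type*} {s : Finset ι} {φ : ι → (Fin 4 → ℝ) → ℝ} {x : Fin 4 → ℝ}
    (hφ : ∀ k ∈ s, DifferentiableAt ℝ (φ k) x) (i : Fin 4) :
    partialD i (fun y => ∑ k ∈ s, φ k y) x = ∑ k ∈ s, partialD i (φ k) x := by
  simp only [partialD, fderiv_fun_sum hφ, sum_apply]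

theorem partialD_mul {φ ψ : (Fin 4 → ℝ) → ℝ} {x : Fin 4 → ℝ} (hφ : DifferentiableAt ℝ φ x)
    (hψ : DifferentiableAt ℝ ψ x) (i : Fin 4) :
    partialD i (fun y => φ y * ψ y) x = partialD i φ x * ψ x + φ x * partialD i ψ x := by
  simp only [partialD, fderiv_fun_mul hφ hψ, add_apply,
    smul_apply, smul_eq_mul]
  ring

theorem partialD_neg (φ : (Fin 4 → ℝ) → ℝ) (x : Fin 4 → ℝ) (i : Fin 4) :
    partialD i (fun y => -φ y) x = -partialD i φ x := by
  simp only [partialD, fderiv_fun_neg, neg_apply]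

theorem partialD_const (r : ℝ) (x : Fin 4 → ℝ) (i : Fin 4) :
    partialD i (fun _ => r) x = 0 := by
  simp [partialD]

theorem partialD_apply (j : Fin 4) (x : Fin 4 → ℝ) (i : Fin 4) :
    partialD i (fun y => y j) x = if i = j then 1 else 0 := by
  simp [partialD, fderiv_apply, Pi.single_apply, eq_comm]

theorem partialD_comp {φ : ℝ → ℝ} {φ' : ℝ} {ψ : (Fin 4 → ℝ) → ℝ} {x : Fin 4 → ℝ}
    (hφ : HasDerivAt φ φ' (ψ x)) (hψ : DifferentiableAt ℝ ψ x) (i : Fin 4) :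
    partialD i (fun y => φ (ψ y)) x = φ' * partialD i ψ x := by
  have := (hφ.comp_hasFDerivAt x hψ.hasFDerivAt).fderiv
  simp only [Function.comp_def] at this
  simp only [partialD, this, smul_apply, smul_eq_mul]

theorem partialD_comm {φ : (Fin 4 → ℝ) → ℝ} {x : Fin 4 → ℝ} (hφ : ContDiffAt ℝ ∞ φ x)
    (i j : Fin 4) : partialD i (partialD j φ) x = partialD j (partialD i φ) x := by
  have hd : DifferentiableAt ℝ (fderiv ℝ φ) x :=
    (hφ.fderiv_right (m := 1) (by norm_cast)).differentiableAt (by simp)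
  have key : ∀ k l : Fin 4, partialD k (partialD l φ) x
      = fderiv ℝ (fderiv ℝ φ) x (Pi.single k 1) (Pi.single l 1) := by
    intro k l
    have : partialD l φ = fun y => fderiv ℝ φ y (Pi.single l 1) := rfl
    rw [this, partialD, fderiv_clm_apply hd (by fun_prop)]
    simp
  rw [key, key]
  exact (hφ.isSymmSndFDerivAt (by simp only [minSmoothness_of_isRCLikeNormedField]; exact WithTop.coe_le_coe.2 (le_top : ((2 : ℕ) : ℕ∞) ≤ ⊤))).eq _ _

theorem contDiffOn_partialD {φ : (Fin 4 → ℝ) → ℝ} {U : Set (Fin 4 → ℝ)} (hU : IsOpen U)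
    (hφ : ContDiffOn ℝ ∞ φ U) (i : Fin 4) : ContDiffOn ℝ ∞ (partialD i φ) U :=
  (hφ.fderiv_of_isOpen hU (m := ∞) (by simp)).clm_apply contDiffOn_const

/-! ### Smoothness of the Levi-Civita connection and of its curvature -/

theorem contDiffOn_det {n : ℕ} {g : (Fin 4 → ℝ) → Matrix (Fin n) (Fin n) ℝ} {U : Set (Fin 4 → ℝ)}
    (hg : ∀ i j, ContDiffOn ℝ ∞ (fun x => g x i j) U) : ContDiffOn ℝ ∞ (fun x => (g x).det) U := by
  simp only [Matrix.det_apply']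
  exact ContDiffOn.sum fun σ _ => contDiffOn_const.mul (contDiffOn_prod fun i _ => hg _ _)

theorem contDiffOn_inv_apply {n : ℕ} {g : (Fin 4 → ℝ) → Matrix (Fin n) (Fin n) ℝ}
    {U : Set (Fin 4 → ℝ)} (hg : ∀ i j, ContDiffOn ℝ ∞ (fun x => g x i j) U)
    (hdet : ∀ x ∈ U, (g x).det ≠ 0) (i j : Fin n) :
    ContDiffOn ℝ ∞ (fun x => (g x)⁻¹ i j) U := by
  simp only [Matrix.inv_def, Matrix.smul_apply, smul_eq_mul, Ring.inverse_eq_inv',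
    Matrix.adjugate_apply]
  refine ((contDiffOn_det hg).inv hdet).mul (contDiffOn_det fun k l => ?_)
  by_cases h : k = j
  · subst h; simpa using contDiffOn_const
  · simpa [Matrix.updateRow_ne h] using hg k l

theorem contDiffOn_christoffel {g : (Fin 4 → ℝ) → Matrix (Fin 4) (Fin 4) ℝ} {U : Set (Fin 4 → ℝ)}
    (hU : IsOpen U) (hg : ∀ i j, ContDiffOn ℝ ∞ (fun x => g x i j) U)
    (hdet : ∀ x ∈ U, (g x).det ≠ 0) (k i j : Fin 4) :
    ContDiffOn ℝ ∞ (christoffel g k i j) U :=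
  contDiffOn_const.mul (ContDiffOn.sum fun l _ => (contDiffOn_inv_apply hg hdet k l).mul
    (((contDiffOn_partialD hU (hg j l) i).add (contDiffOn_partialD hU (hg i l) j)).sub
      (contDiffOn_partialD hU (hg i j) l)))

theorem contDiffOn_ricciMatrix {g : (Fin 4 → ℝ) → Matrix (Fin 4) (Fin 4) ℝ} {U : Set (Fin 4 → ℝ)}
    (hU : IsOpen U) (hg : ∀ i j, ContDiffOn ℝ ∞ (fun x => g x i j) U)
    (hdet : ∀ x ∈ U, (g x).det ≠ 0) (i j : Fin 4) :
    ContDiffOn ℝ ∞ (fun x => ricciMatrix g x i j) U := by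
  have hΓ := contDiffOn_christoffel hU hg hdet
  simp only [ricciMatrix, Matrix.of_apply]
  exact ContDiffOn.sum fun k _ =>
    ((contDiffOn_partialD hU (hΓ _ _ _) _).sub (contDiffOn_partialD hU (hΓ _ _ _) _)).add
      (ContDiffOn.sum fun l _ => ((hΓ _ _ _).mul (hΓ _ _ _)).sub ((hΓ _ _ _).mul (hΓ _ _ _)))

theorem continuousOn_ricci {g : (Fin 4 → ℝ) → Matrix (Fin 4) (Fin 4) ℝ} {U : Set (Fin 4 → ℝ)}
    (hU : IsOpen U) (hg : ∀ i j, ContDiffOn ℝ ∞ (fun x => g x i j) U)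
    (hdet : ∀ x ∈ U, (g x).det ≠ 0) (a b : Fin 4 → ℝ) :
    ContinuousOn (fun x => ricci g x a b) U := by
  simp only [ricci]
  exact continuousOn_finsetSum _ fun i _ => continuousOn_finsetSum _ fun j _ =>
    (continuousOn_const.mul (contDiffOn_ricciMatrix hU hg hdet i j).continuousOn).mul
      continuousOn_const

theorem christoffel_congr {g g' : (Fin 4 → ℝ) → Matrix (Fin 4) (Fin 4) ℝ} {x : Fin 4 → ℝ}
    (h : g =ᶠ[𝓝 x] g') (k i j : Fin 4) : christoffel g k i j x = christoffel g' k i j x := by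
  have e : ∀ m i j, partialD m (fun y => g y i j) x = partialD m (fun y => g' y i j) x :=
    fun m i j => partialD_congr (h.mono fun y hy => by simp only [hy]) m
  simp only [christoffel, e, h.eq_of_nhds]

/-- The Ricci tensor at a point depends only on the germ of the metric. -/
theorem ricci_congr {g g' : (Fin 4 → ℝ) → Matrix (Fin 4) (Fin 4) ℝ} {x : Fin 4 → ℝ}
    (h : g =ᶠ[𝓝 x] g') (a b : Fin 4 → ℝ) : ricci g x a b = ricci g' x a b := by
  have e : ∀ k i j, christoffel g k i j =ᶠ[𝓝 x] christoffel g' k i j :=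
    fun k i j => h.eventually_nhds.mono fun y hy => christoffel_congr hy k i j
  have e' : ∀ m k i j, partialD m (christoffel g k i j) x = partialD m (christoffel g' k i j) x :=
    fun m k i j => partialD_congr (e k i j) m
  simp only [ricci, ricciMatrix, Matrix.of_apply, e', (e _ _ _).eq_of_nhds]

/-! ### Cartan's structure equations -/

/-- The entrywise partial derivative of a matrix valued function. -/
noncomputable def matD (i : Fin 4) (M : (Fin 4 → ℝ) → Matrix (Fin 4) (Fin 4) ℝ) (x : Fin 4 → ℝ) :
    Matrix (Fin 4) (Fin 4) ℝ :=
  Matrix.of fun a b => partialD i (fun y => M y a b) x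

theorem matD_congr {M N : (Fin 4 → ℝ) → Matrix (Fin 4) (Fin 4) ℝ} {x : Fin 4 → ℝ}
    (h : M =ᶠ[𝓝 x] N) (i : Fin 4) : matD i M x = matD i N x := by
  ext a b
  exact partialD_congr (h.mono fun y hy => by simp only [hy]) i

theorem matD_add {M N : (Fin 4 → ℝ) → Matrix (Fin 4) (Fin 4) ℝ} {x : Fin 4 → ℝ}
    (hM : ∀ a b, DifferentiableAt ℝ (fun y => M y a b) x)
    (hN : ∀ a b, DifferentiableAt ℝ (fun y => N y a b) x) (i : Fin 4) :
    matD i (fun y => M y + N y) x = matD i M x + matD i N x := by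
  ext a b
  exact partialD_add (hM a b) (hN a b) i

theorem matD_mul {M N : (Fin 4 → ℝ) → Matrix (Fin 4) (Fin 4) ℝ} {x : Fin 4 → ℝ}
    (hM : ∀ a b, DifferentiableAt ℝ (fun y => M y a b) x)
    (hN : ∀ a b, DifferentiableAt ℝ (fun y => N y a b) x) (i : Fin 4) :
    matD i (fun y => M y * N y) x = matD i M x * N x + M x * matD i N x := by
  ext a b
  simp only [matD, Matrix.of_apply, Matrix.mul_apply, Matrix.add_apply]
  rw [partialD_sum fun k _ => (hM a k).fun_mul (hN k b), ← Finset.sum_add_distrib]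
  exact Finset.sum_congr rfl fun k _ => partialD_mul (hM a k) (hN k b) i

/-- The matrix `Γᵢ = (Γᵏᵢⱼ)ₖⱼ` of `∇ᵢ` in the coordinate frame. -/
noncomputable def christoffelMatrix (g : (Fin 4 → ℝ) → Matrix (Fin 4) (Fin 4) ℝ) (i : Fin 4)
    (x : Fin 4 → ℝ) : Matrix (Fin 4) (Fin 4) ℝ :=
  Matrix.of fun k j => christoffel g k i j x

/-- The curvature `∂ₖ Ωⱼ - ∂ⱼ Ωₖ + [Ωₖ, Ωⱼ]` of the connection `d + Ω`, where `Ω` is given by its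
components `Ωᵢ`. -/
noncomputable def curvatureMatrix (Ω : Fin 4 → (Fin 4 → ℝ) → Matrix (Fin 4) (Fin 4) ℝ)
    (k j : Fin 4) (x : Fin 4 → ℝ) : Matrix (Fin 4) (Fin 4) ℝ :=
  matD k (Ω j) x - matD j (Ω k) x + (Ω k x * Ω j x - Ω j x * Ω k x)

theorem christoffel_symm {g : (Fin 4 → ℝ) → Matrix (Fin 4) (Fin 4) ℝ}
    (hsymm : ∀ x i j, g x i j = g x j i) (k i j : Fin 4) :
    christoffel g k i j = christoffel g k j i := by
  funext x
  simp only [christoffel]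
  congr 1
  refine Finset.sum_congr rfl fun l _ => ?_
  have : (fun y => g y i j) = fun y => g y j i := funext fun y => hsymm y i j
  rw [this]
  ring

theorem ricciMatrix_eq_curvature {g : (Fin 4 → ℝ) → Matrix (Fin 4) (Fin 4) ℝ}
    (hsymm : ∀ x i j, g x i j = g x j i) (x : Fin 4 → ℝ) (i j : Fin 4) :
    ricciMatrix g x i j = ∑ k, curvatureMatrix (christoffelMatrix g) k j x k i := by
  simp only [ricciMatrix, curvatureMatrix, matD, christoffelMatrix, Matrix.of_apply,
    Matrix.sub_apply, Matrix.add_apply, Matrix.mul_apply]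
  refine Finset.sum_congr rfl fun k _ => ?_
  rw [christoffel_symm hsymm k i j, christoffel_symm hsymm k i k, ← Finset.sum_sub_distrib]
  congr 1
  refine Finset.sum_congr rfl fun l _ => ?_
  rw [christoffel_symm hsymm l i j, christoffel_symm hsymm l i k]

/-- The Levi-Civita connection from the first structure equation: if the rows of `Θ` are an
orthonormal coframe and `Ω` is skew-symmetric with `dΘ + Ω ∧ Θ = 0`, then `Ω` is the matrix of the
Levi-Civita connection in the dual frame. -/
theorem mul_christoffelMatrix {g Θ : (Fin 4 → ℝ) → Matrix (Fin 4) (Fin 4) ℝ} {x : Fin 4 → ℝ}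
    (hg : g =ᶠ[𝓝 x] fun y => (Θ y).transpose * Θ y)
    (hΘ : ∀ a b, DifferentiableAt ℝ (fun y => Θ y a b) x) (hdet : (Θ x).det ≠ 0)
    {Ω : Fin 4 → Matrix (Fin 4) (Fin 4) ℝ} (hskew : ∀ i, (Ω i).transpose = -Ω i)
    (htorsion : ∀ a i j, (matD i Θ x + Ω i * Θ x) a j = (matD j Θ x + Ω j * Θ x) a i)
    (i : Fin 4) : Θ x * christoffelMatrix g i x = matD i Θ x + Ω i * Θ x := by
  have hu : IsUnit (Θ x).det := isUnit_iff_ne_zero.2 hdet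
  have dg : ∀ m, matD m g x = (matD m Θ x + Ω m * Θ x).transpose * Θ x
      + (Θ x).transpose * (matD m Θ x + Ω m * Θ x) := by
    intro m
    have ht : matD m (fun y => (Θ y).transpose) x = (matD m Θ x).transpose := rfl
    rw [matD_congr hg, matD_mul (M := fun y => (Θ y).transpose) (fun a b => hΘ b a) hΘ, ht, Matrix.transpose_add,
      Matrix.transpose_mul, hskew]
    noncomm_ring
  set N : Fin 4 → Matrix (Fin 4) (Fin 4) ℝ := fun m => matD m Θ x + Ω m * Θ x with hN
  have dg' : ∀ m a b, partialD m (fun y => g y a b) x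
      = (∑ p, N m p a * Θ x p b) + ∑ p, Θ x p a * N m p b := by
    intro m a b
    exact congrFun (congrFun (dg m) a) b
  have key : christoffelMatrix g i x = (g x)⁻¹ * ((Θ x).transpose * N i) := by
    ext k j
    simp only [christoffelMatrix, Matrix.of_apply, christoffel, dg', Matrix.mul_apply,
      Finset.mul_sum (Finset.univ) _ ((1:ℝ)/2)]
    refine Finset.sum_congr rfl fun l _ => ?_
    rw [mul_left_comm]
    congr 1
    simp only [Matrix.transpose_apply]
    rw [← Finset.sum_add_distrib, ← Finset.sum_add_distrib, ← Finset.sum_add_distrib,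
      ← Finset.sum_add_distrib, ← Finset.sum_sub_distrib, Finset.mul_sum]
    refine Finset.sum_congr rfl fun p _ => ?_
    have e1 : N j p i = N i p j := htorsion p j i
    have e2 : N l p i = N i p l := htorsion p l i
    have e3 : N l p j = N j p l := htorsion p l j
    rw [e1, e2, e3]
    ring
  rw [key, hg.eq_of_nhds, Matrix.mul_inv_rev, ← Matrix.mul_assoc, ← Matrix.mul_assoc,
    ← Matrix.mul_assoc, Matrix.mul_nonsing_inv _ hu, Matrix.one_mul, Matrix.nonsing_inv_mul _
    (by rwa [Matrix.det_transpose]), Matrix.one_mul]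

/-- Curvature transforms as a tensor under the change of frame `Θ`. -/
theorem mul_curvatureMatrix {U : Set (Fin 4 → ℝ)} (hU : IsOpen U)
    {Θ : (Fin 4 → ℝ) → Matrix (Fin 4) (Fin 4) ℝ}
    {Γ Ω : Fin 4 → (Fin 4 → ℝ) → Matrix (Fin 4) (Fin 4) ℝ}
    (hΘ : ∀ a b, ContDiffOn ℝ ∞ (fun y => Θ y a b) U)
    (hΓ : ∀ i a b, DifferentiableOn ℝ (fun y => Γ i y a b) U)
    (hΩ : ∀ i a b, DifferentiableOn ℝ (fun y => Ω i y a b) U)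
    (h : ∀ y ∈ U, ∀ i, Θ y * Γ i y = matD i Θ y + Ω i y * Θ y) {x : Fin 4 → ℝ} (hx : x ∈ U)
    (k j : Fin 4) : Θ x * curvatureMatrix Γ k j x = curvatureMatrix Ω k j x * Θ x := by
  have nb := hU.mem_nhds hx
  have dΘ : ∀ a b, DifferentiableAt ℝ (fun y => Θ y a b) x := fun a b =>
    ((hΘ a b).contDiffAt nb).differentiableAt (by simp)
  have dΓ : ∀ i a b, DifferentiableAt ℝ (fun y => Γ i y a b) x := fun i a b =>
    (hΓ i a b).differentiableAt nb
  have dΩ : ∀ i a b, DifferentiableAt ℝ (fun y => Ω i y a b) x := fun i a b =>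
    (hΩ i a b).differentiableAt nb
  have dM : ∀ i a b, DifferentiableAt ℝ (fun y => matD i Θ y a b) x := fun i a b =>
    ((contDiffOn_partialD hU (hΘ a b) i).contDiffAt nb).differentiableAt (by simp)
  have dΩΘ : ∀ i a b, DifferentiableAt ℝ (fun y => (Ω i y * Θ y) a b) x := fun i a b => by
    simp only [Matrix.mul_apply]
    exact DifferentiableAt.fun_sum fun l _ => (dΩ i a l).mul (dΘ l b)
  have der : ∀ k j, matD k Θ x * Γ j x + Θ x * matD k (Γ j) x
      = matD k (matD j Θ) x + (matD k (Ω j) x * Θ x + Ω j x * matD k Θ x) := by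
    intro k j
    rw [← matD_mul dΘ (dΓ j), ← matD_mul (dΩ j) dΘ, ← matD_add (dM j) (dΩΘ j)]
    exact matD_congr (Filter.eventually_of_mem nb fun y hy => h y hy j) k
  have comm : matD k (matD j Θ) x = matD j (matD k Θ) x := by
    ext a b
    exact partialD_comm ((hΘ a b).contDiffAt nb) k j
  have e1 := der k j
  have e2 := der j k
  have h1 := h x hx k
  have h2 := h x hx j
  rw [comm] at e1
  have e3 : Θ x * matD k (Γ j) x - Θ x * matD j (Γ k) x
      = matD k (Ω j) x * Θ x + Ω j x * matD k Θ x - (matD j (Ω k) x * Θ x + Ω k x * matD j Θ x)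
        - matD k Θ x * Γ j x + matD j Θ x * Γ k x := by
    rw [eq_sub_of_add_eq' e1, eq_sub_of_add_eq' e2]; abel
  calc Θ x * curvatureMatrix Γ k j x
      = (Θ x * matD k (Γ j) x - Θ x * matD j (Γ k) x)
        + ((Θ x * Γ k x) * Γ j x - (Θ x * Γ j x) * Γ k x) := by
        rw [curvatureMatrix]; noncomm_ring
    _ = matD k (Ω j) x * Θ x + Ω j x * matD k Θ x - (matD j (Ω k) x * Θ x + Ω k x * matD j Θ x)
        + (Ω k x * (Θ x * Γ j x) - Ω j x * (Θ x * Γ k x)) := by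
        rw [e3, h1, h2]
        rw [← h1, ← h2]
        have : matD k Θ x * Γ j x = Θ x * Γ k x * Γ j x - Ω k x * (Θ x * Γ j x) := by
          rw [h1]; noncomm_ring
        have : matD j Θ x * Γ k x = Θ x * Γ j x * Γ k x - Ω j x * (Θ x * Γ k x) := by
          rw [h2]; noncomm_ring
        simp only [*]
        abel
    _ = curvatureMatrix Ω k j x * Θ x := by
        rw [h1, h2, curvatureMatrix]; noncomm_ring

/-- The Ricci tensor in terms of an orthonormal coframe `Θ`, with dual frame `Θ⁻¹`, and its
connection matrix `Ω`. -/
theorem ricciMatrix_eq_frame {U : Set (Fin 4 → ℝ)} (hU : IsOpen U)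
    {g Θ : (Fin 4 → ℝ) → Matrix (Fin 4) (Fin 4) ℝ} (hsymm : ∀ x i j, g x i j = g x j i)
    (hg : ∀ y ∈ U, g y = (Θ y).transpose * Θ y)
    (hΘ : ∀ a b, ContDiffOn ℝ ∞ (fun y => Θ y a b) U) (hdet : ∀ y ∈ U, (Θ y).det ≠ 0)
    {Ω : Fin 4 → (Fin 4 → ℝ) → Matrix (Fin 4) (Fin 4) ℝ}
    (hΩ : ∀ i a b, DifferentiableOn ℝ (fun y => Ω i y a b) U)
    (hskew : ∀ y ∈ U, ∀ i, (Ω i y).transpose = -Ω i y)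
    (htorsion : ∀ y ∈ U, ∀ a i j,
      (matD i Θ y + Ω i y * Θ y) a j = (matD j Θ y + Ω j y * Θ y) a i)
    {x : Fin 4 → ℝ} (hx : x ∈ U) (i j : Fin 4) :
    ricciMatrix g x i j = ∑ k, ((Θ x)⁻¹ * curvatureMatrix Ω k j x * Θ x) k i := by
  have hu : IsUnit (Θ x).det := isUnit_iff_ne_zero.2 (hdet x hx)
  have sg : ∀ a b, ContDiffOn ℝ ∞ (fun y => g y a b) U := fun a b => by
    refine ContDiffOn.congr (f := fun y => ((Θ y).transpose * Θ y) a b) ?_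
      fun y hy => by simp only [hg y hy]
    simp only [Matrix.mul_apply, Matrix.transpose_apply]
    exact ContDiffOn.sum fun l _ => (hΘ l a).mul (hΘ l b)
  have dg : ∀ y ∈ U, (g y).det ≠ 0 := fun y hy => by
    rw [hg y hy, Matrix.det_mul, Matrix.det_transpose]
    exact mul_ne_zero (hdet y hy) (hdet y hy)
  rw [ricciMatrix_eq_curvature hsymm]
  refine Finset.sum_congr rfl fun k _ => ?_
  rw [Matrix.mul_assoc, ← mul_curvatureMatrix hU (Γ := christoffelMatrix g) hΘ
    (fun m a b => (contDiffOn_christoffel hU sg dg a m b).differentiableOn (by simp)) hΩ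
    (fun y hy m => mul_christoffelMatrix
      (Filter.eventually_of_mem (hU.mem_nhds hy) hg)
      (fun a b => ((hΘ a b).contDiffAt (hU.mem_nhds hy)).differentiableAt (by simp))
      (hdet y hy) (hskew y hy) (htorsion y hy) m) hx, ← Matrix.mul_assoc,
    Matrix.nonsing_inv_mul _ hu, Matrix.one_mul]

/-! ### The profile equation and the bound `-1 < c < 0` -/

/-- The second derivative prescribed by the profile equation, as a function of `h` and `h'`. -/
noncomputable def profileAccel (c u v : ℝ) : ℝ := (4 - 4 * v ^ 2 - u ^ 2 * (1 + c * v ^ 2)) / (2 * u)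

theorem profileAccel_mul {c u v : ℝ} (hu : u ≠ 0) :
    u * profileAccel c u v = 2 - 2 * v ^ 2 - u ^ 2 * (1 + c * v ^ 2) / 2 := by
  unfold profileAccel; field_simp; ring

theorem IsKoisoCaoProfile.hasDerivWithinAt {c β : ℝ} {h : ℝ → ℝ} (hp : IsKoisoCaoProfile c β h)
    {t : ℝ} (ht : t ∈ Set.Icc 0 β) :
    HasDerivWithinAt h (derivWithin h (Set.Icc 0 β) t) (Set.Icc 0 β) t :=
  ((hp.smooth.differentiableOn (by simp)) t ht).hasDerivWithinAt

theorem IsKoisoCaoProfile.accel_eq {c β : ℝ} {h : ℝ → ℝ} (hp : IsKoisoCaoProfile c β h)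
    {t : ℝ} (ht : t ∈ Set.Icc 0 β) :
    iteratedDerivWithin 2 h (Set.Icc 0 β) t
      = profileAccel c (h t) (derivWithin h (Set.Icc 0 β) t) := by
  have := hp.pos t ht
  have e := hp.ode t ht
  rw [profileAccel, eq_div_iff (by positivity)]
  linarith

theorem IsKoisoCaoProfile.hasDerivWithinAt_deriv {c β : ℝ} {h : ℝ → ℝ}
    (hp : IsKoisoCaoProfile c β h) {t : ℝ} (ht : t ∈ Set.Icc 0 β) :
    HasDerivWithinAt (derivWithin h (Set.Icc 0 β))
      (profileAccel c (h t) (derivWithin h (Set.Icc 0 β) t)) (Set.Icc 0 β) t := by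
  have hu := uniqueDiffOn_Icc hp.beta_pos
  have e : iteratedDerivWithin 2 h (Set.Icc 0 β) t
      = derivWithin (derivWithin h (Set.Icc 0 β)) (Set.Icc 0 β) t := by
    rw [iteratedDerivWithin_succ]
    exact derivWithin_congr (fun y hy => by simp only [iteratedDerivWithin_one]) (by simp only [iteratedDerivWithin_one])
  rw [← hp.accel_eq ht, e]
  have d : ContDiffOn ℝ 1 (derivWithin h (Set.Icc 0 β)) (Set.Icc 0 β) :=
    ((contDiffOn_infty_iff_derivWithin hu).1 hp.smooth).2.of_le (by simp)
  exact ((d.differentiableOn (by simp)) t ht).hasDerivWithinAt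

theorem antitoneOn_Icc_of_hasDerivWithinAt {F F' : ℝ → ℝ} {a b : ℝ}
    (hF : ∀ t ∈ Set.Icc a b, HasDerivWithinAt F (F' t) (Set.Icc a b) t)
    (hle : ∀ t ∈ Set.Icc a b, F' t ≤ 0) : AntitoneOn F (Set.Icc a b) := by
  have hd : ∀ t ∈ Set.Ioo a b, HasDerivAt F (F' t) t := fun t ht =>
    (hF t (Set.Ioo_subset_Icc_self ht)).hasDerivAt (Icc_mem_nhds ht.1 ht.2)
  refine antitoneOn_of_deriv_nonpos (convex_Icc a b) (fun t ht => (hF t ht).continuousWithinAt)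
    ?_ ?_ <;> rw [interior_Icc] <;> intro t ht
  · exact (hd t ht).differentiableAt.differentiableWithinAt
  · rw [(hd t ht).deriv]; exact hle t (Set.Ioo_subset_Icc_self ht)

theorem IsKoisoCaoProfile.deriv_nonpos {c β : ℝ} {h : ℝ → ℝ} (hp : IsKoisoCaoProfile c β h)
    {t : ℝ} (ht : t ∈ Set.Icc 0 β) : derivWithin h (Set.Icc 0 β) t ≤ 0 := by
  rcases eq_or_lt_of_le ht.1 with h0 | h0
  · rw [← h0, hp.left_deriv]
  rcases eq_or_lt_of_le ht.2 with h1 | h1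
  · rw [h1, hp.right_deriv]
  · exact (hp.deriv_neg t ⟨h0, h1⟩).le

theorem IsKoisoCaoProfile.two_le_sq {c β : ℝ} {h : ℝ → ℝ} (hp : IsKoisoCaoProfile c β h)
    {t : ℝ} (ht : t ∈ Set.Icc 0 β) : 2 ≤ h t ^ 2 := by
  have := antitoneOn_Icc_of_hasDerivWithinAt (fun t ht => hp.hasDerivWithinAt ht)
    (fun t ht => hp.deriv_nonpos ht) ht (Set.right_mem_Icc.2 hp.beta_pos.le) ht.2
  rw [hp.right_val] at this
  calc (2 : ℝ) = √2 ^ 2 := (Real.sq_sqrt (by norm_num)).symm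
    _ ≤ h t ^ 2 := by gcongr

theorem IsKoisoCaoProfile.hasDerivWithinAt_sq {c β : ℝ} {h : ℝ → ℝ} (hp : IsKoisoCaoProfile c β h)
    {t : ℝ} (ht : t ∈ Set.Icc 0 β) :
    HasDerivWithinAt (fun t => h t ^ 2) (2 * h t * derivWithin h (Set.Icc 0 β) t)
      (Set.Icc 0 β) t := by
  simpa using (hp.hasDerivWithinAt ht).fun_pow 2

theorem IsKoisoCaoProfile.hasDerivWithinAt_exp {c β : ℝ} {h : ℝ → ℝ}
    (hp : IsKoisoCaoProfile c β h) (κ : ℝ) {t : ℝ} (ht : t ∈ Set.Icc 0 β) :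
    HasDerivWithinAt (fun t => Real.exp (κ * h t ^ 2 / 2))
      (Real.exp (κ * h t ^ 2 / 2) * (κ * (2 * h t * derivWithin h (Set.Icc 0 β) t) / 2))
      (Set.Icc 0 β) t :=
  (((hp.hasDerivWithinAt_sq ht).const_mul κ).div_const 2).exp

/-- As a function of `s = h²`, the quantity `p = h'²` solves a linear equation of first order, with
integrating factor `s² exp (c s / 2)`. -/
theorem IsKoisoCaoProfile.hasDerivWithinAt_firstIntegral {c β : ℝ} {h : ℝ → ℝ}
    (hp : IsKoisoCaoProfile c β h) {t : ℝ} (ht : t ∈ Set.Icc 0 β) :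
    HasDerivWithinAt
      (fun t => (h t ^ 2) ^ 2 * Real.exp (c * h t ^ 2 / 2) * derivWithin h (Set.Icc 0 β) t ^ 2)
      (h t * derivWithin h (Set.Icc 0 β) t * h t ^ 2 * (4 - h t ^ 2) * Real.exp (c * h t ^ 2 / 2))
      (Set.Icc 0 β) t := by
  have hpos := hp.pos t ht
  have e := profileAccel_mul (c := c) (v := derivWithin h (Set.Icc 0 β) t) hpos.ne'
  refine ((((hp.hasDerivWithinAt_sq ht).fun_pow 2).fun_mul (hp.hasDerivWithinAt_exp c ht)).fun_mul
    ((hp.hasDerivWithinAt_deriv ht).fun_pow 2)).congr_deriv ?_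
  push_cast
  linear_combination (2 * h t ^ 3 * derivWithin h (Set.Icc 0 β) t * Real.exp (c * h t ^ 2 / 2)) * e

theorem IsKoisoCaoProfile.const_neg {c β : ℝ} {h : ℝ → ℝ} (hp : IsKoisoCaoProfile c β h) :
    c < 0 := by
  by_contra! hc
  have hβ := hp.beta_pos.le
  -- `4 s - s²` has integral `< 0` over `[2, 6]`, and the weight `exp (c s / 2)` only makes it worse
  have anti := antitoneOn_Icc_of_hasDerivWithinAt
    (F := fun t => Real.exp (2 * c) * ((h t ^ 2) ^ 2 - (h t ^ 2) ^ 3 / 6)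
      - (h t ^ 2) ^ 2 * Real.exp (c * h t ^ 2 / 2) * derivWithin h (Set.Icc 0 β) t ^ 2)
    (fun t ht => ((((hp.hasDerivWithinAt_sq ht).fun_pow 2).fun_sub
      (((hp.hasDerivWithinAt_sq ht).fun_pow 3).div_const 6)).const_mul (Real.exp (2 * c))).fun_sub
      (hp.hasDerivWithinAt_firstIntegral ht)) (fun t ht => by
      have h1 := hp.pos t ht
      have h2 := hp.deriv_nonpos ht
      have h3 : 0 ≤ (4 - h t ^ 2) * (Real.exp (2 * c) - Real.exp (c * h t ^ 2 / 2)) := by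
        rcases le_total (h t ^ 2) 4 with h4 | h4
        · exact mul_nonneg (by linarith) (sub_nonneg.2 (Real.exp_le_exp.2 (by nlinarith)))
        · exact mul_nonneg_of_nonpos_of_nonpos (by linarith)
            (sub_nonpos.2 (Real.exp_le_exp.2 (by nlinarith)))
      have h5 : h t ^ 3 * derivWithin h (Set.Icc 0 β) t ≤ 0 :=
        mul_nonpos_of_nonneg_of_nonpos (by positivity) h2
      have h6 := mul_nonpos_of_nonpos_of_nonneg h5 h3
      push_cast
      linarith)
    (Set.left_mem_Icc.2 hβ) (Set.right_mem_Icc.2 hβ) hβ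
  simp only [hp.left_val, hp.right_val, hp.left_deriv, hp.right_deriv] at anti
  rw [Real.sq_sqrt (by norm_num), Real.sq_sqrt (by norm_num)] at anti
  have := Real.exp_pos (2 * c)
  norm_num at anti
  linarith

theorem IsKoisoCaoProfile.neg_one_lt_const {c β : ℝ} {h : ℝ → ℝ} (hp : IsKoisoCaoProfile c β h) :
    -1 < c := by
  by_contra! hc
  have hβ := hp.beta_pos.le
  -- for `c = -1` the integral of `(4 s - s²) exp (c s / 2)` is that of `(2 s² exp (-s / 2))'`, which
  -- is positive over `[2, 6]` since `exp 2 < 9`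
  have anti := antitoneOn_Icc_of_hasDerivWithinAt
    (F := fun t => (h t ^ 2) ^ 2 * Real.exp (c * h t ^ 2 / 2) * derivWithin h (Set.Icc 0 β) t ^ 2
      - Real.exp (2 * (c + 1)) * ((h t ^ 2) ^ 2 * Real.exp (-1 * h t ^ 2 / 2)))
    (fun t ht => (hp.hasDerivWithinAt_firstIntegral ht).fun_sub
      ((((hp.hasDerivWithinAt_sq ht).fun_pow 2).fun_mul
        (hp.hasDerivWithinAt_exp (-1) ht)).const_mul (Real.exp (2 * (c + 1))))) (fun t ht => by
      have h1 := hp.pos t ht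
      have h2 := hp.deriv_nonpos ht
      have h3 : 0 ≤ (4 - h t ^ 2) * (Real.exp (c * h t ^ 2 / 2)
          - Real.exp (2 * (c + 1)) * Real.exp (-1 * h t ^ 2 / 2)) := by
        rw [← Real.exp_add]
        rcases le_total (h t ^ 2) 4 with h4 | h4
        · exact mul_nonneg (by linarith) (sub_nonneg.2 (Real.exp_le_exp.2 (by nlinarith)))
        · exact mul_nonneg_of_nonpos_of_nonpos (by linarith)
            (sub_nonpos.2 (Real.exp_le_exp.2 (by nlinarith)))
      have h5 : h t ^ 3 * derivWithin h (Set.Icc 0 β) t ≤ 0 :=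
        mul_nonpos_of_nonneg_of_nonpos (by positivity) h2
      have h6 := mul_nonpos_of_nonpos_of_nonneg h5 h3
      push_cast
      linarith)
    (Set.left_mem_Icc.2 hβ) (Set.right_mem_Icc.2 hβ) hβ
  simp only [hp.left_val, hp.right_val, hp.left_deriv, hp.right_deriv] at anti
  rw [Real.sq_sqrt (by norm_num), Real.sq_sqrt (by norm_num)] at anti
  have h1 := Real.exp_pos (2 * (c + 1))
  norm_num at anti
  have h2 := Real.exp_pos (-3)
  have h3 : Real.exp (-1) = Real.exp (-3) * (Real.exp 1 * Real.exp 1) := by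
    rw [← Real.exp_add, ← Real.exp_add]; norm_num
  have h4 : Real.exp 1 * Real.exp 1 < 9 := by
    have := Real.exp_one_lt_d9
    have := Real.exp_pos 1
    nlinarith
  rw [h3] at anti
  have := mul_lt_mul_of_pos_left h4 (mul_pos h1 h2)
  linarith

/-- `f² = h² h'² ≤ h² - 2`: in the variable `s = h²` this is the comparison of `f²` with its tangent
line at `s = 2`. -/
theorem IsKoisoCaoProfile.sq_mul_deriv_sq_le {c β : ℝ} {h : ℝ → ℝ} (hp : IsKoisoCaoProfile c β h)
    {t : ℝ} (ht : t ∈ Set.Icc 0 β) :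
    h t ^ 2 * derivWithin h (Set.Icc 0 β) t ^ 2 ≤ h t ^ 2 - 2 := by
  have hc := hp.neg_one_lt_const
  have hβ := hp.beta_pos.le
  have anti := antitoneOn_Icc_of_hasDerivWithinAt
    (F := fun t => ((h t ^ 2) ^ 2 - 2 * h t ^ 2) * Real.exp (c * h t ^ 2 / 2)
      - (h t ^ 2) ^ 2 * Real.exp (c * h t ^ 2 / 2) * derivWithin h (Set.Icc 0 β) t ^ 2)
    (fun t ht => ((((hp.hasDerivWithinAt_sq ht).fun_pow 2).fun_sub
      ((hp.hasDerivWithinAt_sq ht).const_mul 2)).fun_mul (hp.hasDerivWithinAt_exp c ht)).fun_sub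
      (hp.hasDerivWithinAt_firstIntegral ht)) (fun t ht => by
      have h1 := hp.pos t ht
      have h2 := hp.two_le_sq ht
      have h3 : h t * derivWithin h (Set.Icc 0 β) t * Real.exp (c * h t ^ 2 / 2) ≤ 0 :=
        mul_nonpos_of_nonpos_of_nonneg (mul_nonpos_of_nonneg_of_nonpos h1.le (hp.deriv_nonpos ht))
          (Real.exp_pos _).le
      have h4 : 0 ≤ (h t ^ 2 - 2) * (c * h t ^ 2 + h t ^ 2 + 2) :=
        mul_nonneg (by linarith) (by nlinarith)
      have h5 := mul_nonpos_of_nonpos_of_nonneg h3 h4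
      push_cast
      linarith)
    ht (Set.right_mem_Icc.2 hβ) ht.2
  simp only [hp.right_val, hp.right_deriv] at anti
  rw [Real.sq_sqrt (by norm_num)] at anti
  have h1 := hp.pos t ht
  have h2 : 0 < h t ^ 2 * Real.exp (c * h t ^ 2 / 2) := by positivity
  norm_num at anti
  refine le_of_mul_le_mul_left ?_ h2
  linarith

theorem IsKoisoCaoProfile.one_add_le_ricY {c β : ℝ} {h : ℝ → ℝ} (hp : IsKoisoCaoProfile c β h)
    {t : ℝ} (ht : t ∈ Set.Icc 0 β) : 1 + c ≤ ricY c β h t := by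
  have h1 := hp.sq_mul_deriv_sq_le ht
  have h2 := hp.two_le_sq ht
  have hc := hp.const_neg
  have h3 : derivWithin h (Set.Icc 0 β) t ^ 2 ≤ 1 := by
    by_contra! h3
    nlinarith
  unfold ricY
  nlinarith

theorem IsKoisoCaoProfile.one_add_le_ricH {c β : ℝ} {h : ℝ → ℝ} (hp : IsKoisoCaoProfile c β h)
    {t : ℝ} (ht : t ∈ Set.Icc 0 β) : 1 + c ≤ ricH c β h t := by
  have h1 := hp.sq_mul_deriv_sq_le ht
  have hc := hp.const_neg
  have hc' := hp.neg_one_lt_const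
  have e := profileAccel_mul (c := c) (v := derivWithin h (Set.Icc 0 β) t) (hp.pos t ht).ne'
  rw [ricH, hp.accel_eq ht, e]
  have h4 : 0 ≤ h t ^ 2 * derivWithin h (Set.Icc 0 β) t ^ 2 := by positivity
  have h5 : 0 ≤ derivWithin h (Set.Icc 0 β) t ^ 2 := sq_nonneg _
  have h6 := mul_nonneg (by linarith : (0:ℝ) ≤ 1 + c) h4
  have h7 : 2 - 2 * derivWithin h (Set.Icc 0 β) t ^ 2
      - h t ^ 2 * (1 + c * derivWithin h (Set.Icc 0 β) t ^ 2) / 2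
      + derivWithin h (Set.Icc 0 β) t ^ 2 ≤ 1 := by linarith
  nlinarith

/-! ### Even functions and rotationally symmetric functions -/

theorem contDiffOn_deriv_Ioo {φ : ℝ → ℝ} {a b : ℝ} (hφ : ContDiffOn ℝ ∞ φ (Set.Ioo a b)) :
    ContDiffOn ℝ ∞ (deriv φ) (Set.Ioo a b) :=
  ((contDiffOn_infty_iff_deriv_of_isOpen isOpen_Ioo).1 hφ).2

theorem mul_mem_Ioo_neg {β t s : ℝ} (ht : t ∈ Set.Ioo (-β) β) (hs : s ∈ Set.Icc (0 : ℝ) 1) :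
    t * s ∈ Set.Ioo (-β) β := by
  rw [Set.mem_Ioo, ← abs_lt] at ht ⊢
  rw [abs_mul, abs_of_nonneg hs.1]
  exact (mul_le_of_le_one_right (abs_nonneg t) hs.2).trans_lt ht

theorem continuousOn_pow_mul_scale {φ : ℝ → ℝ} {β : ℝ} (hφ : ContinuousOn φ (Set.Ioo (-β) β))
    (k : ℕ) {t : ℝ} (ht : t ∈ Set.Ioo (-β) β) :
    ContinuousOn (fun s : ℝ => s ^ k * φ (t * s)) (Set.uIcc 0 1) := by
  rw [Set.uIcc_of_le zero_le_one]
  exact (by fun_prop : Continuous fun s : ℝ => s ^ k).continuousOn.mul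
    (hφ.comp (by fun_prop) fun s hs => mul_mem_Ioo_neg ht hs)

theorem hasDerivAt_integral_scale {φ : ℝ → ℝ} {β : ℝ} (hφ : ContDiffOn ℝ ∞ φ (Set.Ioo (-β) β))
    (k : ℕ) {t : ℝ} (ht : t ∈ Set.Ioo (-β) β) :
    HasDerivAt (fun t => ∫ s in (0 : ℝ)..1, s ^ k * φ (t * s))
      (∫ s in (0 : ℝ)..1, s ^ (k + 1) * deriv φ (t * s)) t := by
  obtain ⟨R, htR, hRβ⟩ := exists_between (abs_lt.2 ht)
  have sub : Set.Icc (-R) R ⊆ Set.Ioo (-β) β := fun x hx =>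
    ⟨by linarith [hx.1], by linarith [hx.2]⟩
  have cd := (contDiffOn_deriv_Ioo hφ).continuousOn
  obtain ⟨C, hC⟩ := isCompact_Icc.exists_bound_of_continuousOn (cd.mono sub)
  have mem : ∀ x ∈ Set.Ioo (-R) R, ∀ s ∈ Set.Icc (0 : ℝ) 1, x * s ∈ Set.Icc (-R) R :=
    fun x hx s hs => Set.Ioo_subset_Icc_self (mul_mem_Ioo_neg hx hs)
  have sub' : Set.Ioo (-R) R ⊆ Set.Ioo (-β) β := Set.Ioo_subset_Icc_self.trans sub
  have nb : Set.Ioo (-R) R ∈ 𝓝 t := isOpen_Ioo.mem_nhds (abs_lt.1 htR)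
  have I := fun x hx => (continuousOn_pow_mul_scale hφ.continuousOn k (t := x)
    (sub' hx)).intervalIntegrable (μ := MeasureTheory.volume)
  have I' := (continuousOn_pow_mul_scale cd (k + 1) ht).intervalIntegrable
    (μ := MeasureTheory.volume)
  have unit : ∀ s ∈ Set.uIoc (0 : ℝ) 1, s ∈ Set.Icc (0 : ℝ) 1 := fun s hs => by
    rw [Set.uIoc_of_le zero_le_one] at hs; exact Set.Ioc_subset_Icc_self hs
  refine (intervalIntegral.hasDerivAt_integral_of_dominated_loc_of_deriv_le
    (F := fun x s => s ^ k * φ (x * s)) (F' := fun x s => s ^ (k + 1) * deriv φ (x * s))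
    (bound := fun _ => C) nb (Filter.eventually_of_mem nb fun x hx => ?_)
    (I t (abs_lt.1 htR)) ?_ (Filter.Eventually.of_forall fun s hs x hx => ?_)
    intervalIntegrable_const (Filter.Eventually.of_forall fun s hs x hx => ?_)).2
  · exact (intervalIntegrable_iff.1 (I x hx)).aestronglyMeasurable
  · exact (intervalIntegrable_iff.1 I').aestronglyMeasurable
  · have h1 := hC _ (mem x hx s (unit s hs))
    have h2 : |s ^ (k + 1)| ≤ 1 := by
      rw [abs_of_nonneg (pow_nonneg (unit s hs).1 _)]
      exact pow_le_one₀ (unit s hs).1 (unit s hs).2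
    rw [norm_mul, Real.norm_eq_abs]
    exact (mul_le_of_le_one_left (norm_nonneg _) h2).trans h1
  · have hd : HasDerivAt φ (deriv φ (x * s)) (x * s) :=
      ((hφ.contDiffAt (isOpen_Ioo.mem_nhds (sub (mem x hx s (unit s hs))))).differentiableAt
        (by simp)).hasDerivAt
    have := (hd.comp x ((hasDerivAt_id x).mul_const s)).const_mul (s ^ k)
    refine this.congr_deriv ?_
    simp only [one_mul]; ring

theorem contDiffOn_integral_scale (n : ℕ) : ∀ {φ : ℝ → ℝ} {β : ℝ} (k : ℕ),
    ContDiffOn ℝ ∞ φ (Set.Ioo (-β) β) →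
    ContDiffOn ℝ n (fun t => ∫ s in (0 : ℝ)..1, s ^ k * φ (t * s)) (Set.Ioo (-β) β) := by
  induction n with
  | zero =>
    intro φ β k hφ
    exact contDiffOn_zero.2 fun t ht =>
      (hasDerivAt_integral_scale hφ k ht).continuousAt.continuousWithinAt
  | succ n ih =>
    intro φ β k hφ
    push_cast
    refine (contDiffOn_succ_iff_deriv_of_isOpen isOpen_Ioo).2 ⟨fun t ht =>
      (hasDerivAt_integral_scale hφ k ht).differentiableAt.differentiableWithinAt, by simp, ?_⟩
    exact (ih (k + 1) (contDiffOn_deriv_Ioo hφ)).congr fun t ht =>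
      (hasDerivAt_integral_scale hφ k ht).deriv

/-- Hadamard's lemma in one variable. -/
theorem contDiffOn_dslope_zero {φ : ℝ → ℝ} {β : ℝ} (hφ : ContDiffOn ℝ ∞ φ (Set.Ioo (-β) β)) :
    ContDiffOn ℝ ∞ (dslope φ 0) (Set.Ioo (-β) β) := by
  have cd := contDiffOn_deriv_Ioo hφ
  refine contDiffOn_infty.2 fun n => (contDiffOn_integral_scale n 0 cd).congr fun t ht => ?_
  rcases eq_or_ne t 0 with rfl | h0
  · simp
  have I := (continuousOn_pow_mul_scale cd.continuousOn 0 ht).intervalIntegrable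
    (μ := MeasureTheory.volume)
  have ftc := intervalIntegral.integral_eq_sub_of_hasDerivAt (f := fun s => φ (t * s))
    (f' := fun s => t * (s ^ 0 * deriv φ (t * s))) (a := 0) (b := 1) (fun s hs => by
      rw [Set.uIcc_of_le zero_le_one] at hs
      have hd : HasDerivAt φ (deriv φ (t * s)) (t * s) :=
        ((hφ.contDiffAt (isOpen_Ioo.mem_nhds (mul_mem_Ioo_neg ht hs))).differentiableAt
          (by simp)).hasDerivAt
      refine (hd.comp s ((hasDerivAt_id s).const_mul t)).congr_deriv ?_
      simp only [mul_one, pow_zero, one_mul]; ring) (I.const_mul t)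
  rw [intervalIntegral.integral_const_mul] at ftc
  rw [dslope_of_ne _ h0, slope_def_field, sub_zero, div_eq_iff h0, mul_comm, ftc]
  simp

theorem dslope_zero_neg {φ : ℝ → ℝ} (hodd : ∀ t, φ (-t) = -φ t) (t : ℝ) :
    dslope φ 0 (-t) = dslope φ 0 t := by
  have h0 : φ 0 = 0 := by have := hodd 0; simp at this; linarith
  rcases eq_or_ne t 0 with rfl | ht
  · simp
  · rw [dslope_of_ne _ ht, dslope_of_ne _ (neg_ne_zero.2 ht), slope_def_field, slope_def_field,
      hodd, h0]
    simp [neg_div_neg_eq]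

theorem deriv_neg_of_even {φ : ℝ → ℝ} (heven : ∀ t, φ (-t) = φ t) (t : ℝ) :
    deriv φ (-t) = -deriv φ t := by
  have := deriv_comp_neg φ t
  simp only [heven] at this
  linarith

section Radial

variable {E : Type*} [NormedAddCommGroup E] [InnerProductSpace ℝ E]

theorem hasFDerivAt_comp_norm {φ : ℝ → ℝ} {β : ℝ} (hφ : ContDiffOn ℝ ∞ φ (Set.Ioo (-β) β))
    (heven : ∀ t, φ (-t) = φ t) {w : E} (hw : ‖w‖ < β) :
    HasFDerivAt (fun w : E => φ ‖w‖) (dslope (deriv φ) 0 ‖w‖ • innerSL ℝ w) w := by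
  have hβ : 0 < β := (norm_nonneg w).trans_lt hw
  have h0 : deriv φ 0 = 0 := by
    have := deriv_neg_of_even heven 0; rw [neg_zero] at this; linarith
  have hd : HasDerivAt φ (deriv φ ‖w‖) ‖w‖ :=
    ((hφ.contDiffAt (isOpen_Ioo.mem_nhds ⟨by linarith [norm_nonneg w], hw⟩)).differentiableAt
      (by simp)).hasDerivAt
  rcases eq_or_ne w 0 with rfl | hw0
  · rw [norm_zero, h0] at hd
    have hl : (fun t => φ t - φ 0) =o[𝓝 0] fun t => t := by
      simpa [hasDerivAt_iff_isLittleO] using hd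
    have ht : Filter.Tendsto (fun w : E => ‖w‖) (𝓝 0) (𝓝 0) := by
      simpa using (continuous_norm (E := E)).tendsto 0
    simp only [map_zero, smul_zero]
    refine .of_isLittleO ?_
    refine Asymptotics.isLittleO_norm_right.1 ?_
    simpa [Function.comp_def] using hl.comp_tendsto ht
  · have hn := (contDiffAt_norm ℝ hw0 (n := 1)).differentiableAt (by simp)
    have hnw := norm_pos_iff.2 hw0
    refine (hd.comp_hasFDerivAt w hn.hasFDerivAt).congr_fderiv ?_
    have e : fderiv ℝ (fun w : E => ‖w‖) w = ‖w‖⁻¹ • innerSL ℝ w := by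
      have h2 : HasFDerivAt (fun w : E => ‖w‖ ^ 2) _ w := hn.hasFDerivAt.pow 2
      have h3 := (hasStrictFDerivAt_norm_sq w).hasFDerivAt
      have h4 := h2.unique h3
      ext y
      have h5 := congrArg (fun L => L y) h4
      simp at h5
      simp
      rw [inv_mul_eq_div, eq_div_iff hnw.ne']
      linarith
    rw [e, smul_smul, dslope_of_ne _ hnw.ne', slope_def_field, h0]
    simp [div_eq_mul_inv]

theorem contDiffOn_comp_norm_nat (n : ℕ) : ∀ {φ : ℝ → ℝ} {β : ℝ},
    ContDiffOn ℝ ∞ φ (Set.Ioo (-β) β) → (∀ t, φ (-t) = φ t) →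
    ContDiffOn ℝ n (fun w : E => φ ‖w‖) {w | ‖w‖ < β} := by
  induction n with
  | zero =>
    intro φ β hφ heven
    exact contDiffOn_zero.2 fun w hw =>
      (hasFDerivAt_comp_norm hφ heven hw).continuousAt.continuousWithinAt
  | succ n ih =>
    intro φ β hφ heven
    push_cast
    have ho : IsOpen {w : E | ‖w‖ < β} := isOpen_lt continuous_norm continuous_const
    refine (contDiffOn_succ_iff_fderiv_of_isOpen ho).2 ⟨fun w hw =>
      (hasFDerivAt_comp_norm hφ heven hw).differentiableAt.differentiableWithinAt, by simp, ?_⟩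
    refine ContDiffOn.congr ?_ fun w hw => (hasFDerivAt_comp_norm hφ heven hw).fderiv
    exact (ih (contDiffOn_dslope_zero (contDiffOn_deriv_Ioo hφ))
      (dslope_zero_neg (deriv_neg_of_even heven))).smul (innerSL ℝ).contDiff.contDiffOn

/-- A smooth even function of the norm is smooth, also at the origin. -/
theorem contDiffOn_comp_norm {φ : ℝ → ℝ} {β : ℝ} (hφ : ContDiffOn ℝ ∞ φ (Set.Ioo (-β) β))
    (heven : ∀ t, φ (-t) = φ t) : ContDiffOn ℝ ∞ (fun w : E => φ ‖w‖) {w | ‖w‖ < β} :=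
  contDiffOn_infty.2 fun n => contDiffOn_comp_norm_nat n hφ heven

end Radial

/-! ### The profile seen from a singular orbit -/

theorem hasDerivAt_comp_abs {k : ℝ → ℝ} {m t β : ℝ} (hβ : 0 < β) (ht : t ∈ Set.Ioo (-β) β)
    (hk : HasDerivWithinAt k m (Set.Icc 0 β) |t|) (h0 : t = 0 → m = 0) :
    HasDerivAt (fun t => k |t|) (SignType.sign t * m) t := by
  rcases lt_trichotomy t 0 with hneg | rfl | hpos
  · have hk' := hk.hasDerivAt (Icc_mem_nhds (abs_pos.2 hneg.ne) (abs_lt.2 ht))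
    refine (hk'.comp t (hasDerivAt_abs_neg hneg)).congr_deriv ?_
    simp [sign_neg hneg]
  · obtain rfl := h0 rfl
    rw [abs_zero] at hk
    have hr : HasDerivWithinAt k 0 (Set.Ici 0) 0 := hk.mono_of_mem_nhdsWithin
      (Icc_mem_nhdsGE hβ)
    have hl : HasDerivWithinAt (fun t => k (-t)) 0 (Set.Iic 0) 0 := by
      have hr' : HasDerivWithinAt k 0 (Set.Ici 0) (-0 : ℝ) := by rwa [neg_zero]
      simpa [Function.comp_def] using hr'.scomp (0 : ℝ) (hasDerivAt_neg (0 : ℝ)).hasDerivWithinAt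
        (fun x hx => neg_nonneg.2 (Set.mem_Iic.1 hx))
    have e1 : HasDerivWithinAt (fun t => k |t|) 0 (Set.Ici 0) 0 :=
      hr.congr (fun y hy => by rw [abs_of_nonneg hy]) (by simp)
    have e2 : HasDerivWithinAt (fun t => k |t|) 0 (Set.Iic 0) 0 :=
      hl.congr (fun y hy => by rw [abs_of_nonpos hy]) (by simp)
    have := e1.union e2
    rw [Set.Ici_union_Iic, hasDerivWithinAt_univ] at this
    simpa using this
  · have hk' := hk.hasDerivAt (Icc_mem_nhds (abs_pos.2 hpos.ne') (abs_lt.2 ht))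
    refine (hk'.comp t (hasDerivAt_abs_pos hpos)).congr_deriv ?_
    simp [sign_pos hpos]

theorem hasDerivAt_sign_mul_comp_abs {l : ℝ → ℝ} {m t β : ℝ} (hβ : 0 < β)
    (ht : t ∈ Set.Ioo (-β) β) (hl : HasDerivWithinAt l m (Set.Icc 0 β) |t|) (hl0 : l 0 = 0) :
    HasDerivAt (fun t => SignType.sign t * l |t|) m t := by
  rcases lt_trichotomy t 0 with hneg | rfl | hpos
  · have hl' := hl.hasDerivAt (Icc_mem_nhds (abs_pos.2 hneg.ne) (abs_lt.2 ht))
    have := (hl'.comp t (hasDerivAt_abs_neg hneg)).neg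
    refine (this.congr_deriv (by ring)).congr_of_eventuallyEq ?_
    filter_upwards [gt_mem_nhds hneg] with y hy
    simp [sign_neg hy]
  · rw [abs_zero] at hl
    have hr : HasDerivWithinAt l m (Set.Ici 0) 0 := hl.mono_of_mem_nhdsWithin
      (Icc_mem_nhdsGE hβ)
    have hle : HasDerivWithinAt (fun t => -l (-t)) m (Set.Iic 0) 0 := by
      have hr' : HasDerivWithinAt l m (Set.Ici 0) (-0 : ℝ) := by rwa [neg_zero]
      simpa [Function.comp_def] using (hr'.scomp (0 : ℝ) (hasDerivAt_neg (0 : ℝ)).hasDerivWithinAt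
        (fun x hx => neg_nonneg.2 (Set.mem_Iic.1 hx))).fun_neg
    have e1 : HasDerivWithinAt (fun t => SignType.sign t * l |t|) m (Set.Ici 0) 0 :=
      hr.congr (fun y hy => by
        rcases eq_or_lt_of_le (Set.mem_Ici.1 hy) with rfl | hy'
        · simp [hl0]
        · simp [abs_of_pos hy', sign_pos hy']) (by simp [hl0])
    have e2 : HasDerivWithinAt (fun t => SignType.sign t * l |t|) m (Set.Iic 0) 0 :=
      hle.congr (fun y hy => by
        rcases eq_or_lt_of_le (Set.mem_Iic.1 hy) with rfl | hy'
        · simp [hl0]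
        · simp [abs_of_neg hy', sign_neg hy']) (by simp [hl0])
    have := e1.union e2
    rwa [Set.Ici_union_Iic, hasDerivWithinAt_univ] at this
  · have hl' := hl.hasDerivAt (Icc_mem_nhds (abs_pos.2 hpos.ne') (abs_lt.2 ht))
    have := (hl'.comp t (hasDerivAt_abs_pos hpos))
    refine (this.congr_deriv (by ring)).congr_of_eventuallyEq ?_
    filter_upwards [lt_mem_nhds hpos] with y hy
    simp [sign_pos hy]

/-- The profile as a function `u` of the signed distance to a singular orbit, with derivative `v`.
Both singular orbits give such a pair, by even reflection. The condition on `u 0` holds for `√6`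
and for `√2`; it makes `(u v)'(0) = ±1`, so that the metric has no cone angle. -/
structure IsEvenProfile (c β : ℝ) (u v : ℝ → ℝ) : Prop where
  even : ∀ t, u (-t) = u t
  odd : ∀ t, v (-t) = -v t
  pos : ∀ t ∈ Set.Ioo (-β) β, 0 < u t
  hasDerivAt : ∀ t ∈ Set.Ioo (-β) β, HasDerivAt u (v t) t
  hasDerivAt_deriv : ∀ t ∈ Set.Ioo (-β) β, HasDerivAt v (profileAccel c (u t) (v t)) t
  ne_zero : ∀ t ∈ Set.Ioo 0 β, v t ≠ 0
  sq_zero : (u 0 ^ 2 - 4) ^ 2 = 4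

/-- The parameter `t` at signed distance `r` from the singular orbit `e`. -/
noncomputable def orbitParam (β : ℝ) (e : Fin 2) (r : ℝ) : ℝ := if e = 0 then |r| else β - |r|

/-- `h` as a function of the signed distance to the singular orbit `e`. -/
noncomputable def orbitProfile (β : ℝ) (h : ℝ → ℝ) (e : Fin 2) (r : ℝ) : ℝ := h (orbitParam β e r)

/-- The derivative of `orbitProfile`. -/
noncomputable def orbitProfileDeriv (β : ℝ) (h : ℝ → ℝ) (e : Fin 2) (r : ℝ) : ℝ :=
  SignType.sign r *
    ((if e = 0 then 1 else -1) * derivWithin h (Set.Icc 0 β) (orbitParam β e r))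

theorem orbitParam_mem_Icc {β r : ℝ} (e : Fin 2) (hr : r ∈ Set.Ioo (-β) β) :
    orbitParam β e r ∈ Set.Icc 0 β := by
  have h1 := abs_lt.2 hr
  have h2 := abs_nonneg r
  unfold orbitParam
  split_ifs <;> constructor <;> linarith

theorem orbitParam_mem_Ioo {β r : ℝ} (e : Fin 2) (hr : r ∈ Set.Ioo 0 β) :
    orbitParam β e r ∈ Set.Ioo 0 β := by
  have h1 := abs_of_pos hr.1
  unfold orbitParam
  split_ifs <;> constructor <;> linarith [hr.1, hr.2]

theorem IsKoisoCaoProfile.isEvenProfile {c β : ℝ} {h : ℝ → ℝ} (hp : IsKoisoCaoProfile c β h)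
    (e : Fin 2) : IsEvenProfile c β (orbitProfile β h e) (orbitProfileDeriv β h e) := by
  have hβ := hp.beta_pos
  set h' := derivWithin h (Set.Icc 0 β) with hh'
  have mem : ∀ t ∈ Set.Ioo (-β) β, |t| ∈ Set.Icc 0 β := fun t ht =>
    ⟨abs_nonneg t, (abs_lt.2 ht).le⟩
  have refl : Set.MapsTo (fun t => β - t) (Set.Icc 0 β) (Set.Icc 0 β) := fun t ht =>
    ⟨by linarith [ht.2], by linarith [ht.1]⟩
  have signsq : ∀ t : ℝ, t ≠ 0 → (SignType.sign t : ℝ) ^ 2 = 1 := fun t ht => by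
    rcases lt_or_gt_of_ne ht with h1 | h1
    · simp [sign_neg h1]
    · simp [sign_pos h1]
  -- the profile read off from the orbit `e`, on `[0, β]`
  obtain ⟨k, l, hk, hl, hl0, hu, hv⟩ : ∃ k l : ℝ → ℝ,
      (∀ t ∈ Set.Icc 0 β, HasDerivWithinAt k (l t) (Set.Icc 0 β) t) ∧
      (∀ t ∈ Set.Icc 0 β, HasDerivWithinAt l (profileAccel c (k t) (l t)) (Set.Icc 0 β) t) ∧
      l 0 = 0 ∧ (∀ t, orbitProfile β h e t = k |t|) ∧
      (∀ t, orbitProfileDeriv β h e t = SignType.sign t * l |t|) := by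
    by_cases he : e = 0
    · exact ⟨h, h', fun t ht => hp.hasDerivWithinAt ht, fun t ht => hp.hasDerivWithinAt_deriv ht,
        hp.left_deriv, fun t => by simp [orbitProfile, orbitParam, he],
        fun t => by simp [orbitProfileDeriv, orbitParam, he, hh']⟩
    · refine ⟨fun t => h (β - t), fun t => -h' (β - t), fun t ht => ?_, fun t ht => ?_,
        by simpa using hp.right_deriv, fun t => by simp [orbitProfile, orbitParam, he],
        fun t => by simp [orbitProfileDeriv, orbitParam, he, hh']⟩
      · have := (hp.hasDerivWithinAt (refl ht)).scomp t
          ((hasDerivAt_id t).const_sub β).hasDerivWithinAt refl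
        simpa [Function.comp_def] using this
      · have := ((hp.hasDerivWithinAt_deriv (refl ht)).scomp t
          ((hasDerivAt_id t).const_sub β).hasDerivWithinAt refl).fun_neg
        simpa [Function.comp_def, profileAccel] using this
  refine ⟨fun t => by simp [orbitProfile, orbitParam], fun t => ?_, fun t ht =>
    hp.pos _ (orbitParam_mem_Icc e ht), fun t ht => ?_, fun t ht => ?_, fun t ht => ?_, ?_⟩
  · rw [hv, hv]; simp [Left.sign_neg]
  · rw [funext hu, hv]
    exact hasDerivAt_comp_abs hβ ht (hk _ (mem t ht)) (fun h0 => by simp [h0, hl0])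
  · rw [funext hv, hu]
    have hd := hasDerivAt_sign_mul_comp_abs hβ ht (hl _ (mem t ht)) hl0
    refine hd.congr_deriv ?_
    rcases eq_or_ne t 0 with rfl | h0
    · simp [hl0]
    · simp only [profileAccel, mul_pow, signsq t h0, one_mul]
  · have h1 := hp.deriv_neg _ (orbitParam_mem_Ioo e ht)
    have h2 : (if e = 0 then (1 : ℝ) else -1) ≠ 0 := by split_ifs <;> norm_num
    simp only [orbitProfileDeriv, sign_pos ht.1, SignType.coe_one, one_mul]
    exact mul_ne_zero h2 h1.ne
  · by_cases he : e = 0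
    · simp [orbitProfile, orbitParam, he, hp.left_val]; norm_num
    · simp [orbitProfile, orbitParam, he, hp.right_val]; norm_num

namespace IsEvenProfile

/-- Solutions of the profile equation are smooth by bootstrapping, so that even reflection creates
no singularity at `0`. -/
theorem contDiffOn {c β : ℝ} {u v : ℝ → ℝ} (hp : IsEvenProfile c β u v) :
    ContDiffOn ℝ ∞ u (Set.Ioo (-β) β) ∧ ContDiffOn ℝ ∞ v (Set.Ioo (-β) β) := by
  have key : ∀ n : ℕ, ContDiffOn ℝ n u (Set.Ioo (-β) β) ∧ ContDiffOn ℝ n v (Set.Ioo (-β) β) := by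
    intro n
    induction n with
    | zero =>
      exact ⟨contDiffOn_zero.2 fun t ht => (hp.hasDerivAt t ht).continuousAt.continuousWithinAt,
        contDiffOn_zero.2 fun t ht => (hp.hasDerivAt_deriv t ht).continuousAt.continuousWithinAt⟩
    | succ n ih =>
      obtain ⟨iu, iv⟩ := ih
      push_cast
      refine ⟨(contDiffOn_succ_iff_deriv_of_isOpen isOpen_Ioo).2 ⟨fun t ht =>
          (hp.hasDerivAt t ht).differentiableAt.differentiableWithinAt, by simp, ?_⟩,
        (contDiffOn_succ_iff_deriv_of_isOpen isOpen_Ioo).2 ⟨fun t ht =>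
          (hp.hasDerivAt_deriv t ht).differentiableAt.differentiableWithinAt, by simp, ?_⟩⟩
      · exact iv.congr fun t ht => (hp.hasDerivAt t ht).deriv
      · refine ContDiffOn.congr ?_ fun t ht => (hp.hasDerivAt_deriv t ht).deriv
        unfold profileAccel
        exact ((contDiffOn_const.sub (contDiffOn_const.mul (iv.pow 2))).sub
          ((iu.pow 2).mul (contDiffOn_const.add (contDiffOn_const.mul (iv.pow 2))))).div
          (contDiffOn_const.mul iu) fun t ht => by have := hp.pos t ht; positivity
  exact ⟨contDiffOn_infty.2 fun n => (key n).1, contDiffOn_infty.2 fun n => (key n).2⟩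

end IsEvenProfile

/-- `(u v / r)²`, extended over `r = 0`. -/
noncomputable def fibreFactor (u v : ℝ → ℝ) (r : ℝ) : ℝ := dslope (fun t => -(u t * v t)) 0 r ^ 2

/-- `(fibreFactor - 1) / r²`, extended over `r = 0`. -/
noncomputable def fibreDefect (u v : ℝ → ℝ) : ℝ → ℝ := dslope (dslope (fibreFactor u v) 0) 0

namespace IsEvenProfile

theorem deriv_zero {c β : ℝ} {u v : ℝ → ℝ} (hp : IsEvenProfile c β u v) : v 0 = 0 := by
  have := hp.odd 0
  rw [neg_zero] at this
  linarith

theorem fibreFactor_zero {c β : ℝ} {u v : ℝ → ℝ} (hp : IsEvenProfile c β u v) (hβ : 0 < β) :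
    fibreFactor u v 0 = 1 := by
  have h0 : (0 : ℝ) ∈ Set.Ioo (-β) β := ⟨by linarith, hβ⟩
  have hd := ((hp.hasDerivAt 0 h0).fun_mul (hp.hasDerivAt_deriv 0 h0)).fun_neg
  have e := profileAccel_mul (c := c) (v := v 0) (hp.pos 0 h0).ne'
  rw [fibreFactor, dslope_same, hd.deriv, e, hp.deriv_zero]
  linear_combination (1 / 4) * hp.sq_zero

theorem fibreFactor_mul {c β : ℝ} {u v : ℝ → ℝ} (hp : IsEvenProfile c β u v) (r : ℝ) :
    fibreFactor u v r * r ^ 2 = (u r * v r) ^ 2 := by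
  have := sub_smul_dslope (fun t => -(u t * v t)) 0 r
  simp only [sub_zero, smul_eq_mul, hp.deriv_zero, mul_zero, neg_zero] at this
  rw [fibreFactor]
  linear_combination (r * dslope (fun t => -(u t * v t)) 0 r - u r * v r) * this

theorem contDiffOn_fibreFactor {c β : ℝ} {u v : ℝ → ℝ} (hp : IsEvenProfile c β u v) :
    ContDiffOn ℝ ∞ (fibreFactor u v) (Set.Ioo (-β) β) :=
  (contDiffOn_dslope_zero (hp.contDiffOn.1.mul hp.contDiffOn.2).neg).pow 2

theorem fibreFactor_neg {c β : ℝ} {u v : ℝ → ℝ} (hp : IsEvenProfile c β u v) (r : ℝ) :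
    fibreFactor u v (-r) = fibreFactor u v r := by
  rw [fibreFactor, fibreFactor, dslope_zero_neg fun t => by rw [hp.even, hp.odd, mul_neg]]

theorem dslope_fibreFactor_neg {c β : ℝ} {u v : ℝ → ℝ} (hp : IsEvenProfile c β u v) (r : ℝ) :
    dslope (fibreFactor u v) 0 (-r) = -dslope (fibreFactor u v) 0 r := by
  rcases eq_or_ne r 0 with rfl | h0
  · have := deriv_neg_of_even hp.fibreFactor_neg 0
    rw [neg_zero] at this
    rw [neg_zero, dslope_same]
    exact this
  · rw [dslope_of_ne _ h0, dslope_of_ne _ (neg_ne_zero.2 h0), slope_def_field, slope_def_field,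
      hp.fibreFactor_neg, sub_zero, sub_zero, div_neg]

theorem contDiffOn_fibreDefect {c β : ℝ} {u v : ℝ → ℝ} (hp : IsEvenProfile c β u v) :
    ContDiffOn ℝ ∞ (fibreDefect u v) (Set.Ioo (-β) β) :=
  contDiffOn_dslope_zero (contDiffOn_dslope_zero hp.contDiffOn_fibreFactor)

theorem fibreDefect_neg {c β : ℝ} {u v : ℝ → ℝ} (hp : IsEvenProfile c β u v) (r : ℝ) :
    fibreDefect u v (-r) = fibreDefect u v r :=
  dslope_zero_neg hp.dslope_fibreFactor_neg r

theorem fibreDefect_mul {c β : ℝ} {u v : ℝ → ℝ} (hp : IsEvenProfile c β u v) (hβ : 0 < β)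
    (r : ℝ) : fibreDefect u v r * r ^ 2 = fibreFactor u v r - 1 := by
  have h1 := sub_smul_dslope (dslope (fibreFactor u v) 0) 0 r
  have h2 := sub_smul_dslope (fibreFactor u v) 0 r
  have h3 := hp.dslope_fibreFactor_neg 0
  rw [neg_zero] at h3
  have h4 : dslope (fibreFactor u v) 0 0 = 0 := by linarith
  simp only [sub_zero, smul_eq_mul, h4, hp.fibreFactor_zero hβ] at h1 h2
  rw [← h2, ← h1, fibreDefect]
  ring

end IsEvenProfile

/-! ### The metric in coordinates -/

/-- `1 + |z|²`. -/
noncomputable def baseDenom (x : Fin 4 → ℝ) : ℝ := 1 + (x 0 ^ 2 + x 1 ^ 2)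

/-- The one-form `Im (z̄ dz) / (1 + |z|²)`, a connection form of the Hopf fibration. -/
noncomputable def hopfForm (x : Fin 4 → ℝ) : Fin 4 → ℝ :=
  ![-(x 1 / baseDenom x), x 0 / baseDenom x, 0, 0]

/-- The one-form `Im (w̄ dw) = |w|² dθ`. -/
def angularForm (x : Fin 4 → ℝ) : Fin 4 → ℝ := ![0, 0, -x 3, x 2]

/-- The Kähler metric with profile `u`, `v = u'` in the coordinates `(z, w)`, written so that it is
manifestly smooth at `w = 0`: it is
`|dw|² + E α² + 2 F α A + F |w|² A² + u² |dz|² / (1 + |z|²)²`, with `A` the `hopfForm`, `α` the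
`angularForm`, `E = fibreDefect` and `F = fibreFactor`. -/
noncomputable def smoothMetric (u v : ℝ → ℝ) (x : Fin 4 → ℝ) : Matrix (Fin 4) (Fin 4) ℝ :=
  Matrix.of fun k l =>
    ((Pi.single 2 1 : Fin 4 → ℝ) k * (Pi.single 2 1 : Fin 4 → ℝ) l
      + (Pi.single 3 1 : Fin 4 → ℝ) k * (Pi.single 3 1 : Fin 4 → ℝ) l)
    + fibreDefect u v ‖coordW x‖ * (angularForm x k * angularForm x l)
    + fibreFactor u v ‖coordW x‖ * (angularForm x k * hopfForm x l + hopfForm x k * angularForm x l)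
    + fibreFactor u v ‖coordW x‖ * (x 2 ^ 2 + x 3 ^ 2) * (hopfForm x k * hopfForm x l)
    + u ‖coordW x‖ ^ 2 / baseDenom x ^ 2 *
      ((Pi.single 0 1 : Fin 4 → ℝ) k * (Pi.single 0 1 : Fin 4 → ℝ) l
        + (Pi.single 1 1 : Fin 4 → ℝ) k * (Pi.single 1 1 : Fin 4 → ℝ) l)

/-- The one-form `dr`, for `r = |w| ≠ 0`. -/
noncomputable def radialForm (x : Fin 4 → ℝ) : Fin 4 → ℝ :=
  ![0, 0, x 2 / ‖coordW x‖, x 3 / ‖coordW x‖]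

/-- The one-form `dθ + A`, for `w ≠ 0`; it is the contact form of `S³`. -/
noncomputable def contactForm (x : Fin 4 → ℝ) : Fin 4 → ℝ :=
  ![-(x 1 / baseDenom x), x 0 / baseDenom x, -(x 3 / (x 2 ^ 2 + x 3 ^ 2)),
    x 2 / (x 2 ^ 2 + x 3 ^ 2)]

/-- The one-form `dxᵃ / (1 + |z|²)`; for `a = 0, 1` these are the real and the imaginary part of
`dz / (1 + |z|²)`. -/
noncomputable def baseForm (a : Fin 4) (x : Fin 4 → ℝ) : Fin 4 → ℝ :=
  (baseDenom x)⁻¹ • Pi.single a 1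

/-- The orthonormal coframe `dr, f (dθ + A), u Re dz / (1 + |z|²), u Im dz / (1 + |z|²)`, with
`f = - u v`. -/
noncomputable def coframe (u v : ℝ → ℝ) (x : Fin 4 → ℝ) : Matrix (Fin 4) (Fin 4) ℝ :=
  ![radialForm x, -(u ‖coordW x‖ * v ‖coordW x‖) • contactForm x,
    u ‖coordW x‖ • baseForm 0 x, u ‖coordW x‖ • baseForm 1 x]

theorem baseDenom_pos (x : Fin 4 → ℝ) : 0 < baseDenom x := by unfold baseDenom; positivity

theorem normSq_coordZ (x : Fin 4 → ℝ) : 1 + Complex.normSq (coordZ x) = baseDenom x := by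
  simp [Complex.normSq_apply, coordZ, baseDenom, sq]

theorem norm_coordW_sq (x : Fin 4 → ℝ) : ‖coordW x‖ ^ 2 = x 2 ^ 2 + x 3 ^ 2 := by
  rw [← Complex.normSq_eq_norm_sq]
  simp [Complex.normSq_apply, coordW, sq]

theorem smoothMetric_symm (u v : ℝ → ℝ) (x : Fin 4 → ℝ) (k l : Fin 4) :
    smoothMetric u v x k l = smoothMetric u v x l k := by
  simp only [smoothMetric, Matrix.of_apply]; ring

theorem isOpen_offCore : IsOpen offCore :=
  isOpen_ne_fun (by
    have : coordW = fun x => Complex.equivRealProdCLM.symm (x 2, x 3) := rfl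
    rw [this]; fun_prop) continuous_const

theorem contDiff_coordW : ContDiff ℝ ∞ coordW := by
  have : coordW = fun x => Complex.equivRealProdCLM.symm (x 2, x 3) := rfl
  rw [this]; fun_prop

theorem isOpen_chartDomain (β : ℝ) : IsOpen (chartDomain β) :=
  isOpen_lt contDiff_coordW.continuous.norm continuous_const

/-- The regular orbits are dense. -/
theorem mem_closure_offCore (x : Fin 4 → ℝ) : x ∈ closure offCore := by
  by_cases hx : x ∈ offCore
  · exact subset_closure hx
  have h0 : coordW x = 0 := by simpa [offCore] using hx
  have hc : ContinuousWithinAt (fun s : ℝ => x + s • (Pi.single 2 1 : Fin 4 → ℝ)) (Set.Ioi 0) 0 := by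
    fun_prop
  have := hc.mem_closure (t := offCore) (by simp) fun s hs => by
    have h2 : x 2 = 0 := congrArg Complex.re h0
    intro h
    have := congrArg Complex.re h
    simp [coordW, h2] at this
    exact (Set.mem_Ioi.1 hs).ne' this
  simpa using this

theorem contDiffOn_radial {φ : ℝ → ℝ} {β : ℝ} (hφ : ContDiffOn ℝ ∞ φ (Set.Ioo (-β) β))
    (heven : ∀ t, φ (-t) = φ t) : ContDiffOn ℝ ∞ (fun x => φ ‖coordW x‖) (chartDomain β) :=
  (contDiffOn_comp_norm (E := ℂ) hφ heven).comp contDiff_coordW.contDiffOn fun _ hx => hx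

theorem contDiff_hopfForm (k : Fin 4) : ContDiff ℝ ∞ fun x => hopfForm x k := by
  have : ∀ x, baseDenom x ≠ 0 := fun x => (baseDenom_pos x).ne'
  have hb : ContDiff ℝ ∞ baseDenom := by unfold baseDenom; fun_prop
  fin_cases k
  · exact ((contDiff_apply ℝ ℝ 1).div hb this).neg
  · exact (contDiff_apply ℝ ℝ 0).div hb this
  · exact contDiff_const
  · exact contDiff_const

theorem contDiff_angularForm (k : Fin 4) : ContDiff ℝ ∞ fun x => angularForm x k := by
  fin_cases k
  · exact contDiff_const
  · exact contDiff_const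
  · exact (contDiff_apply ℝ ℝ 3).neg
  · exact contDiff_apply ℝ ℝ 2

theorem contDiffOn_smoothMetric {c β : ℝ} {u v : ℝ → ℝ} (hp : IsEvenProfile c β u v)
    (k l : Fin 4) : ContDiffOn ℝ ∞ (fun x => smoothMetric u v x k l) (chartDomain β) := by
  have hF := contDiffOn_radial hp.contDiffOn_fibreFactor hp.fibreFactor_neg
  have hE := contDiffOn_radial hp.contDiffOn_fibreDefect hp.fibreDefect_neg
  have hu := contDiffOn_radial hp.contDiffOn.1 hp.even
  have hb : ContDiff ℝ ∞ baseDenom := by unfold baseDenom; fun_prop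
  have hA := fun k => (contDiff_hopfForm k).contDiffOn (s := chartDomain β)
  have hα := fun k => (contDiff_angularForm k).contDiffOn (s := chartDomain β)
  have hr : ContDiff ℝ ∞ fun x : Fin 4 → ℝ => x 2 ^ 2 + x 3 ^ 2 := by fun_prop
  simp only [smoothMetric, Matrix.of_apply]
  exact (((contDiffOn_const.add (hE.mul ((hα k).mul (hα l)))).add
    (hF.mul (((hα k).mul (hA l)).add ((hA k).mul (hα l))))).add
    ((hF.mul hr.contDiffOn).mul ((hA k).mul (hA l)))).add
    (((hu.pow 2).div (hb.contDiffOn.pow 2) fun x _ => (pow_pos (baseDenom_pos x) 2).ne').mul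
      contDiffOn_const)

theorem coframe_transpose_mul_apply (u v : ℝ → ℝ) (x : Fin 4 → ℝ) (k l : Fin 4) :
    ((coframe u v x).transpose * coframe u v x) k l
      = radialForm x k * radialForm x l
        + (u ‖coordW x‖ * v ‖coordW x‖) ^ 2 * (contactForm x k * contactForm x l)
        + u ‖coordW x‖ ^ 2 / baseDenom x ^ 2 *
          ((Pi.single 0 1 : Fin 4 → ℝ) k * (Pi.single 0 1 : Fin 4 → ℝ) l
            + (Pi.single 1 1 : Fin 4 → ℝ) k * (Pi.single 1 1 : Fin 4 → ℝ) l) := by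
  simp only [Matrix.mul_apply, Matrix.transpose_apply, Fin.sum_univ_four]
  simp only [coframe, baseForm, Matrix.cons_val_zero, Matrix.cons_val_one, Matrix.cons_val,
    Pi.smul_apply, smul_eq_mul]
  ring

theorem smoothMetric_eq_coframe {c β : ℝ} {u v : ℝ → ℝ} (hp : IsEvenProfile c β u v)
    (hβ : 0 < β) {x : Fin 4 → ℝ} (hx : x ∈ offCore) :
    smoothMetric u v x = (coframe u v x).transpose * coframe u v x := by
  have hn : 0 < ‖coordW x‖ := norm_pos_iff.2 hx
  have hs := norm_coordW_sq x
  have hr : 0 < x 2 ^ 2 + x 3 ^ 2 := by rw [← hs]; positivity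
  have hF := hp.fibreFactor_mul ‖coordW x‖
  have hE := hp.fibreDefect_mul hβ ‖coordW x‖
  have hb := baseDenom_pos x
  rw [hs] at hF hE
  have hE' : fibreDefect u v ‖coordW x‖ = (fibreFactor u v ‖coordW x‖ - 1) / (x 2 ^ 2 + x 3 ^ 2) := by
    rw [eq_div_iff hr.ne', hE]
  have hc : ∀ k, contactForm x k = hopfForm x k + angularForm x k / (x 2 ^ 2 + x 3 ^ 2) := by
    intro k; fin_cases k <;> simp [contactForm, hopfForm, angularForm, neg_div]
  have hd : ∀ k l, radialForm x k * radialForm x l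
      = ((Pi.single 2 1 : Fin 4 → ℝ) k * (Pi.single 2 1 : Fin 4 → ℝ) l
        + (Pi.single 3 1 : Fin 4 → ℝ) k * (Pi.single 3 1 : Fin 4 → ℝ) l)
        - angularForm x k * angularForm x l / (x 2 ^ 2 + x 3 ^ 2) := by
    intro k l
    rw [eq_sub_iff_add_eq]
    fin_cases k <;> fin_cases l <;> simp [radialForm, angularForm,
      div_mul_div_comm, ← sq, div_pow, hs] <;> field_simp <;> ring
  ext k l
  rw [coframe_transpose_mul_apply, hc, hc, hd, ← hF]
  simp only [smoothMetric, Matrix.of_apply, hE']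
  field_simp
  ring

theorem det_coframe {u v : ℝ → ℝ} {x : Fin 4 → ℝ} (hx : x ∈ offCore) :
    (coframe u v x).det
      = -(u ‖coordW x‖ ^ 3 * v ‖coordW x‖) / (baseDenom x ^ 2 * ‖coordW x‖) := by
  have hn : 0 < ‖coordW x‖ := norm_pos_iff.2 hx
  have hs := norm_coordW_sq x
  have hr : 0 < x 2 ^ 2 + x 3 ^ 2 := by rw [← hs]; positivity
  have hb := baseDenom_pos x
  have e : coframe u v x = !![0, 0, x 2 / ‖coordW x‖, x 3 / ‖coordW x‖;
      -(u ‖coordW x‖ * v ‖coordW x‖) * -(x 1 / baseDenom x),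
      -(u ‖coordW x‖ * v ‖coordW x‖) * (x 0 / baseDenom x),
      -(u ‖coordW x‖ * v ‖coordW x‖) * -(x 3 / (x 2 ^ 2 + x 3 ^ 2)),
      -(u ‖coordW x‖ * v ‖coordW x‖) * (x 2 / (x 2 ^ 2 + x 3 ^ 2));
      u ‖coordW x‖ / baseDenom x, 0, 0, 0; 0, u ‖coordW x‖ / baseDenom x, 0, 0] := by
    ext k l
    fin_cases k <;> fin_cases l <;> simp [coframe, baseForm, radialForm, contactForm, div_eq_mul_inv]
  rw [e, Matrix.det_succ_row_zero]
  simp [Fin.sum_univ_succ, Matrix.det_fin_three, Fin.succAbove]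
  field_simp
  ring

theorem det_coframe_ne_zero {c β : ℝ} {u v : ℝ → ℝ} (hp : IsEvenProfile c β u v)
    {x : Fin 4 → ℝ} (hx : x ∈ offCore) (hxβ : x ∈ chartDomain β) : (coframe u v x).det ≠ 0 := by
  have hn : 0 < ‖coordW x‖ := norm_pos_iff.2 hx
  have hu := hp.pos ‖coordW x‖ ⟨by linarith [show ‖coordW x‖ < β from hxβ], hxβ⟩
  have hv := hp.ne_zero ‖coordW x‖ ⟨hn, hxβ⟩
  have hb := baseDenom_pos x
  rw [det_coframe hx]
  exact div_ne_zero (neg_ne_zero.2 (mul_ne_zero (by positivity) hv)) (by positivity)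

theorem posDef_smoothMetric {c β : ℝ} {u v : ℝ → ℝ} (hp : IsEvenProfile c β u v) (hβ : 0 < β)
    {x : Fin 4 → ℝ} (hxβ : x ∈ chartDomain β) : (smoothMetric u v x).PosDef := by
  by_cases hx : x ∈ offCore
  · rw [smoothMetric_eq_coframe hp hβ hx]
    have hu : IsUnit (coframe u v x) :=
      (Matrix.isUnit_iff_isUnit_det _).2 (isUnit_iff_ne_zero.2 (det_coframe_ne_zero hp hx hxβ))
    have := Matrix.PosDef.conjTranspose_mul_self (coframe u v x)
      (Matrix.mulVec_injective_of_isUnit hu)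
    simpa using this
  · have h0 : coordW x = 0 := by simpa [offCore] using hx
    have h2 : x 2 = 0 := congrArg Complex.re h0
    have h3 : x 3 = 0 := congrArg Complex.im h0
    have hu := hp.pos 0 ⟨by linarith, hβ⟩
    have hb := baseDenom_pos x
    have e : smoothMetric u v x
        = Matrix.diagonal ![u 0 ^ 2 / baseDenom x ^ 2, u 0 ^ 2 / baseDenom x ^ 2, 1, 1] := by
      ext k l
      fin_cases k <;> fin_cases l <;>
        simp [smoothMetric, angularForm, h0, h2, h3, Pi.single_apply]
    rw [e, Matrix.posDef_diagonal_iff]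
    intro k
    fin_cases k <;> simp <;> positivity

/-! ### The pullback of the metric of `S³ × (0, β)` -/

theorem hasFDerivAt_coordZ (x : Fin 4 → ℝ) :
    ∃ L : (Fin 4 → ℝ) →L[ℝ] ℂ, HasFDerivAt coordZ L x ∧ ∀ a, L a = ⟨a 0, a 1⟩ := by
  let L : (Fin 4 → ℝ) →L[ℝ] ℂ := (Complex.equivRealProdCLM.symm : ℝ × ℝ →L[ℝ] ℂ) ∘L
    ((ContinuousLinearMap.proj 0).prod (ContinuousLinearMap.proj 1))
  have e : coordZ = L := rfl
  exact ⟨L, e ▸ L.hasFDerivAt, fun _ => rfl⟩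

theorem hasFDerivAt_coordW (x : Fin 4 → ℝ) :
    ∃ L : (Fin 4 → ℝ) →L[ℝ] ℂ, HasFDerivAt coordW L x ∧ ∀ a, L a = ⟨a 2, a 3⟩ := by
  let L : (Fin 4 → ℝ) →L[ℝ] ℂ := (Complex.equivRealProdCLM.symm : ℝ × ℝ →L[ℝ] ℂ) ∘L
    ((ContinuousLinearMap.proj 2).prod (ContinuousLinearMap.proj 3))
  have e : coordW = L := rfl
  exact ⟨L, e ▸ L.hasFDerivAt, fun _ => rfl⟩

theorem hasFDerivAt_norm_coordW {x : Fin 4 → ℝ} (hx : x ∈ offCore) :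
    ∃ L : (Fin 4 → ℝ) →L[ℝ] ℝ, HasFDerivAt (fun y => ‖coordW y‖) L x ∧
      ∀ a, L a = ∑ k, radialForm x k * a k := by
  have hn : 0 < ‖coordW x‖ := norm_pos_iff.2 hx
  obtain ⟨L, hL, hLa⟩ := hasFDerivAt_coordW x
  have hd : DifferentiableAt ℝ (fun y => ‖coordW y‖) x :=
    hL.differentiableAt.norm ℝ hx
  refine ⟨_, hd.hasFDerivAt, fun a => ?_⟩
  have h2 : HasFDerivAt (fun y => ‖coordW y‖ ^ 2) _ x := hd.hasFDerivAt.pow 2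
  have h3 : HasFDerivAt (fun y => ‖coordW y‖ ^ 2) _ x := hL.norm_sq
  have h4 := congrArg (fun M => M a) (h2.unique h3)
  simp [hLa, Complex.inner, coordW] at h4
  simp [radialForm, Fin.sum_univ_four]
  field_simp
  simp only [coordW]
  linarith

/-- The positive real factor `1 / (|w| √(1 + |z|²))`, for which `v = μ w (1, z)` or
`v = μ w (z, 1)`. -/
noncomputable def liftScale (x : Fin 4 → ℝ) : ℝ := (‖coordW x‖ * √(baseDenom x))⁻¹

theorem liftScale_sq_mul {x : Fin 4 → ℝ} (hx : x ∈ offCore) :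
    liftScale x ^ 2 * (baseDenom x * (x 2 ^ 2 + x 3 ^ 2)) = 1 := by
  have hn : 0 < ‖coordW x‖ := norm_pos_iff.2 hx
  have hs := norm_coordW_sq x
  have hb := baseDenom_pos x
  rw [liftScale, ← hs, inv_pow, mul_pow, Real.sq_sqrt hb.le]
  field_simp

theorem differentiableAt_liftScale {x : Fin 4 → ℝ} (hx : x ∈ offCore) :
    DifferentiableAt ℝ liftScale x := by
  obtain ⟨L, hL, -⟩ := hasFDerivAt_norm_coordW hx
  have hn : 0 < ‖coordW x‖ := norm_pos_iff.2 hx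
  have hb := baseDenom_pos x
  have hbd : DifferentiableAt ℝ baseDenom x := by unfold baseDenom; fun_prop
  exact (hL.differentiableAt.mul (hbd.sqrt hb.ne')).inv
    (mul_pos hn (Real.sqrt_pos.2 hb)).ne'

theorem chartLift_fst_of_mem_offCore (β : ℝ) (i e : Fin 2) {x : Fin 4 → ℝ} (hx : x ∈ offCore) :
    (chartLift β i e x).1
      = ((liftScale x : ℂ) * coordW x) • (if i = 0 then ![1, coordZ x] else ![coordZ x, 1]) := by
  have hw : coordW x ≠ 0 := hx
  simp only [chartLift, phase, if_neg hw, normSq_coordZ, liftScale]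
  congr 1
  push_cast
  rw [div_div, div_eq_mul_inv, mul_comm]

/-- The differential of `chartLift` on the regular part, in terms of the coframe `∂/∂t, X, Y, Z`
dual to `dt, σ_X, σ_Y, σ_Z`: the forms `dt` and `σ_X` pull back to `± dr` and `dθ + A`, and
`σ_Y² + σ_Z²` to the Fubini–Study metric. -/
theorem fderiv_chartLift (β : ℝ) (i e : Fin 2) {x : Fin 4 → ℝ} (hx : x ∈ offCore) :
    (∀ a, (fderiv ℝ (chartLift β i e) x a).2
      = (if e = 0 then 1 else -1) * ∑ k, radialForm x k * a k) ∧
    (∀ a, realInner (fieldX (chartLift β i e x).1) (fderiv ℝ (chartLift β i e) x a).1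
      = ∑ k, contactForm x k * a k) ∧
    (∀ a b, realInner (fieldY (chartLift β i e x).1) (fderiv ℝ (chartLift β i e) x a).1
        * realInner (fieldY (chartLift β i e x).1) (fderiv ℝ (chartLift β i e) x b).1
      + realInner (fieldZ (chartLift β i e x).1) (fderiv ℝ (chartLift β i e) x a).1
        * realInner (fieldZ (chartLift β i e x).1) (fderiv ℝ (chartLift β i e) x b).1
      = (a 0 * b 0 + a 1 * b 1) / baseDenom x ^ 2) := by
  obtain ⟨Lr, hLr, hLra⟩ := hasFDerivAt_norm_coordW hx
  obtain ⟨Lz, hLz, hLza⟩ := hasFDerivAt_coordZ x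
  obtain ⟨Lw, hLw, hLwa⟩ := hasFDerivAt_coordW x
  have hμ := (differentiableAt_liftScale hx).hasFDerivAt
  set m := fderiv ℝ liftScale x with hm
  set μ := liftScale x with hμdef
  have hμC : HasFDerivAt (fun y => (liftScale y : ℂ)) (Complex.ofRealCLM ∘L m) x :=
    Complex.ofRealCLM.hasFDerivAt.comp x hμ
  obtain ⟨Lv, hlam, hlama⟩ : ∃ L : (Fin 4 → ℝ) →L[ℝ] ℂ,
      HasFDerivAt (fun y => (liftScale y : ℂ) * coordW y) L x ∧
        ∀ a, L a = m a * coordW x + μ * Lw a :=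
    ⟨_, hμC.fun_mul hLw, fun a => by simp; ring⟩
  obtain ⟨Lvz, hlz, hlza⟩ : ∃ L : (Fin 4 → ℝ) →L[ℝ] ℂ,
      HasFDerivAt (fun y => (liftScale y : ℂ) * coordW y * coordZ y) L x ∧
        ∀ a, L a = (m a * coordW x + μ * Lw a) * coordZ x + μ * coordW x * Lz a :=
    ⟨_, hlam.fun_mul hLz, fun a => by simp [hlama]; ring⟩
  -- the derivative of `chartLift`
  obtain ⟨D, hD, hD2, hD0, hD1⟩ : ∃ D : (Fin 4 → ℝ) →L[ℝ] (Fin 2 → ℂ) × ℝ,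
      HasFDerivAt (chartLift β i e) D x ∧
      (∀ a, (D a).2 = (if e = 0 then 1 else -1) * Lr a) ∧
      (∀ a, (D a).1 (if i = 0 then 0 else 1) = m a * coordW x + μ * Lw a) ∧
      (∀ a, (D a).1 (if i = 0 then 1 else 0)
        = (m a * coordW x + μ * Lw a) * coordZ x + μ * coordW x * Lz a) := by
    obtain ⟨L2, h2, h2a⟩ : ∃ L : (Fin 4 → ℝ) →L[ℝ] ℝ,
        HasFDerivAt (fun y => (chartLift β i e y).2) L x ∧
          ∀ a, L a = (if e = 0 then 1 else -1) * Lr a := by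
      by_cases he : e = 0
      · exact ⟨Lr, by simpa [chartLift, he] using hLr, by simp [he]⟩
      · exact ⟨-Lr, by simpa [chartLift, he] using hLr.const_sub β, by simp [he]⟩
    have hnb : offCore ∈ 𝓝 x := isOpen_offCore.mem_nhds hx
    by_cases hi : i = 0
    · have h1 : HasFDerivAt (fun y => (chartLift β i e y).1) (ContinuousLinearMap.pi
          ![Lv, Lvz]) x := by
        refine HasFDerivAt.congr_of_eventuallyEq (f := fun y =>
          ![(liftScale y : ℂ) * coordW y, (liftScale y : ℂ) * coordW y * coordZ y]) ?_
          (Filter.eventually_of_mem hnb fun y hy => by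
            simp only [chartLift_fst_of_mem_offCore β i e hy]
            ext k; fin_cases k <;> simp [hi])
        refine hasFDerivAt_pi.2 fun k => ?_
        fin_cases k
        · exact hlam
        · exact hlz
      refine ⟨_, h1.prodMk h2, h2a, fun a => ?_, fun a => ?_⟩
      · simp [hi, hlama]
      · simp [hi, hlza]
    · have h1 : HasFDerivAt (fun y => (chartLift β i e y).1) (ContinuousLinearMap.pi
          ![Lvz, Lv]) x := by
        refine HasFDerivAt.congr_of_eventuallyEq (f := fun y =>
          ![(liftScale y : ℂ) * coordW y * coordZ y, (liftScale y : ℂ) * coordW y]) ?_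
          (Filter.eventually_of_mem hnb fun y hy => by
            simp only [chartLift_fst_of_mem_offCore β i e hy]
            ext k; fin_cases k <;> simp [hi])
        refine hasFDerivAt_pi.2 fun k => ?_
        fin_cases k
        · exact hlz
        · exact hlam
      refine ⟨_, h1.prodMk h2, h2a, fun a => ?_, fun a => ?_⟩
      · simp [hi, hlama]
      · simp [hi, hlza]
  have hsq := liftScale_sq_mul hx
  rw [← hμdef] at hsq
  have hs := norm_coordW_sq x
  have hn : 0 < ‖coordW x‖ := norm_pos_iff.2 hx
  have hr : 0 < x 2 ^ 2 + x 3 ^ 2 := by rw [← hs]; positivity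
  have hb := baseDenom_pos x
  have hbi : (baseDenom x)⁻¹ = μ ^ 2 * (x 2 ^ 2 + x 3 ^ 2) := 
    inv_eq_of_mul_eq_one_right (by linarith)
  have hri : (x 2 ^ 2 + x 3 ^ 2)⁻¹ = μ ^ 2 * baseDenom x := 
    inv_eq_of_mul_eq_one_right (by linarith)
  rw [hD.fderiv, chartLift_fst_of_mem_offCore β i e hx, ← hμdef]
  refine ⟨fun a => by rw [hD2, hLra], fun a => ?_, fun a b => ?_⟩
  · have e0 := hD0 a
    have e1 := hD1 a
    simp only [contactForm, div_eq_mul_inv, hbi, hri, Fin.sum_univ_four]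
    simp only [baseDenom]
    by_cases hi : i = 0
    · simp only [hi, if_true] at e0 e1 ⊢
      simp [realInner, fieldX, e0, e1, hLza, hLwa, coordZ, coordW]
      ring
    · simp only [hi, if_false] at e0 e1 ⊢
      simp [realInner, fieldX, e0, e1, hLza, hLwa, coordZ, coordW]
      ring
  · have e0 := hD0 a
    have e1 := hD1 a
    have f0 := hD0 b
    have f1 := hD1 b
    simp only [div_eq_mul_inv, ← inv_pow, hbi]
    by_cases hi : i = 0
    · simp only [hi, if_true] at e0 e1 f0 f1 ⊢
      simp [realInner, fieldY, fieldZ, e0, e1, f0, f1, hLza, hLwa, coordZ, coordW]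
      ring
    · simp only [hi, if_false] at e0 e1 f0 f1 ⊢
      simp [realInner, fieldY, fieldZ, e0, e1, f0, f1, hLza, hLwa, coordZ, coordW]
      ring

/-! ### The invariant one-forms and their exterior derivatives -/

/-- The exterior derivative of a one-form. -/
noncomputable def extD (α : (Fin 4 → ℝ) → Fin 4 → ℝ) (i j : Fin 4) (x : Fin 4 → ℝ) : ℝ :=
  partialD i (fun y => α y j) x - partialD j (fun y => α y i) x

/-- The wedge product of two covectors. -/
def wedge (a b : Fin 4 → ℝ) (i j : Fin 4) : ℝ := a i * b j - a j * b i

theorem partialD_norm_coordW {x : Fin 4 → ℝ} (hx : x ∈ offCore) (i : Fin 4) :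
    partialD i (fun y => ‖coordW y‖) x = radialForm x i := by
  obtain ⟨L, hL, hLa⟩ := hasFDerivAt_norm_coordW hx
  rw [partialD, hL.fderiv, hLa]
  simp [Pi.single_apply]

theorem contDiffAt_norm_coordW {x : Fin 4 → ℝ} (hx : x ∈ offCore) :
    ContDiffAt ℝ ∞ (fun y => ‖coordW y‖) x :=
  contDiff_coordW.contDiffAt.norm ℝ hx

theorem partialD_radial {φ : ℝ → ℝ} {φ' : ℝ} {x : Fin 4 → ℝ} (hx : x ∈ offCore)
    (hφ : HasDerivAt φ φ' ‖coordW x‖) (i : Fin 4) :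
    partialD i (fun y => φ ‖coordW y‖) x = φ' * radialForm x i := by
  rw [partialD_comp (ψ := fun y => ‖coordW y‖) hφ
    ((contDiffAt_norm_coordW hx).differentiableAt (by simp)), partialD_norm_coordW hx]

theorem extD_radial_smul {φ : ℝ → ℝ} {φ' : ℝ} {α : (Fin 4 → ℝ) → Fin 4 → ℝ} {x : Fin 4 → ℝ}
    (hx : x ∈ offCore) (hφ : HasDerivAt φ φ' ‖coordW x‖)
    (hα : ∀ k, DifferentiableAt ℝ (fun y => α y k) x) (i j : Fin 4) :
    extD (fun y => φ ‖coordW y‖ • α y) i j x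
      = φ' * wedge (radialForm x) (α x) i j + φ ‖coordW x‖ * extD α i j x := by
  have hd : DifferentiableAt ℝ (fun y => φ ‖coordW y‖) x :=
    hφ.differentiableAt.comp x ((contDiffAt_norm_coordW hx).differentiableAt (by simp))
  simp only [extD, wedge, Pi.smul_apply, smul_eq_mul]
  rw [partialD_mul hd (hα j), partialD_mul hd (hα i), partialD_radial hx hφ, partialD_radial hx hφ]
  ring

theorem partialD_div {φ ψ : (Fin 4 → ℝ) → ℝ} {x : Fin 4 → ℝ} (hφ : DifferentiableAt ℝ φ x)
    (hψ : DifferentiableAt ℝ ψ x) (h0 : ψ x ≠ 0) (i : Fin 4) :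
    partialD i (fun y => φ y / ψ y) x
      = (partialD i φ x * ψ x - φ x * partialD i ψ x) / ψ x ^ 2 := by
  have hinv := partialD_comp (hasDerivAt_inv h0) hψ i
  simp only [div_eq_mul_inv]
  rw [partialD_mul hφ (hψ.fun_inv h0), hinv]
  field_simp
  ring

theorem partialD_sq_add_sq (a b : Fin 4) (x : Fin 4 → ℝ) (i : Fin 4) :
    partialD i (fun y => y a ^ 2 + y b ^ 2) x
      = 2 * x a * (if i = a then 1 else 0) + 2 * x b * (if i = b then 1 else 0) := by
  simp only [sq]
  rw [partialD_add (by fun_prop) (by fun_prop), partialD_mul (by fun_prop) (by fun_prop),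
    partialD_mul (by fun_prop) (by fun_prop), partialD_apply, partialD_apply]
  ring

theorem differentiable_baseDenom : Differentiable ℝ baseDenom := by unfold baseDenom; fun_prop

theorem partialD_baseDenom (x : Fin 4 → ℝ) (i : Fin 4) :
    partialD i baseDenom x
      = 2 * x 0 * (if i = 0 then 1 else 0) + 2 * x 1 * (if i = 1 then 1 else 0) := by
  rw [← partialD_sq_add_sq]
  unfold baseDenom
  rw [partialD_add (φ := fun _ => (1 : ℝ)) (by fun_prop) (by fun_prop), partialD_const, zero_add]

theorem partialD_div_baseDenom (a : Fin 4) (x : Fin 4 → ℝ) (i : Fin 4) :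
    partialD i (fun y => y a / baseDenom y) x = ((if i = a then 1 else 0) * baseDenom x
      - x a * (2 * x 0 * (if i = 0 then 1 else 0) + 2 * x 1 * (if i = 1 then 1 else 0)))
        / baseDenom x ^ 2 := by
  rw [partialD_div (by fun_prop) differentiable_baseDenom.differentiableAt (baseDenom_pos x).ne',
    partialD_apply, partialD_baseDenom]

theorem partialD_inv_baseDenom (x : Fin 4 → ℝ) (i : Fin 4) :
    partialD i (fun y => (baseDenom y)⁻¹) x = -(2 * x 0 * (if i = 0 then 1 else 0)
      + 2 * x 1 * (if i = 1 then 1 else 0)) / baseDenom x ^ 2 := by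
  rw [partialD_comp (hasDerivAt_inv (baseDenom_pos x).ne') differentiable_baseDenom.differentiableAt,
    partialD_baseDenom]
  field_simp

theorem sq_add_sq_pos {x : Fin 4 → ℝ} (hx : x ∈ offCore) : 0 < x 2 ^ 2 + x 3 ^ 2 := by
  rw [← norm_coordW_sq]
  have : 0 < ‖coordW x‖ := norm_pos_iff.2 hx
  positivity

theorem partialD_div_sq_add_sq {x : Fin 4 → ℝ} (hx : x ∈ offCore) (a i : Fin 4) :
    partialD i (fun y => y a / (y 2 ^ 2 + y 3 ^ 2)) x
      = ((if i = a then 1 else 0) * (x 2 ^ 2 + x 3 ^ 2)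
        - x a * (2 * x 2 * (if i = 2 then 1 else 0) + 2 * x 3 * (if i = 3 then 1 else 0)))
          / (x 2 ^ 2 + x 3 ^ 2) ^ 2 := by
  rw [partialD_div (by fun_prop) (by fun_prop) (sq_add_sq_pos hx).ne', partialD_apply,
    partialD_sq_add_sq]

theorem extD_radialForm {x : Fin 4 → ℝ} (hx : x ∈ offCore) (i j : Fin 4) :
    extD radialForm i j x = 0 := by
  have e : ∀ k, (fun y => radialForm y k) =ᶠ[𝓝 x] partialD k fun y => ‖coordW y‖ := fun k =>
    Filter.eventually_of_mem (isOpen_offCore.mem_nhds hx) fun y hy => (partialD_norm_coordW hy k).symm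
  rw [extD, partialD_congr (e j), partialD_congr (e i), partialD_comm (contDiffAt_norm_coordW hx),
    sub_self]

theorem extD_hopfForm (x : Fin 4 → ℝ) (i j : Fin 4) :
    extD hopfForm i j x = 2 * wedge (baseForm 0 x) (baseForm 1 x) i j := by
  have hb := (baseDenom_pos x).ne'
  have d : ∀ i j, partialD i (fun y => hopfForm y j) x
      = ![-(((if i = 1 then 1 else 0) * baseDenom x
          - x 1 * (2 * x 0 * (if i = 0 then 1 else 0) + 2 * x 1 * (if i = 1 then 1 else 0)))
            / baseDenom x ^ 2),
        ((if i = 0 then 1 else 0) * baseDenom x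
          - x 0 * (2 * x 0 * (if i = 0 then 1 else 0) + 2 * x 1 * (if i = 1 then 1 else 0)))
            / baseDenom x ^ 2, 0, 0] j := by
    intro i j
    fin_cases j
    · exact (partialD_neg _ x i).trans (congrArg Neg.neg (partialD_div_baseDenom 1 x i))
    · exact partialD_div_baseDenom 0 x i
    · exact partialD_const 0 x i
    · exact partialD_const 0 x i
  have hd : baseDenom x = 1 + (x 0 ^ 2 + x 1 ^ 2) := rfl
  simp only [extD, d, wedge, baseForm]
  fin_cases i <;> fin_cases j <;> simp <;> field_simp <;> rw [hd] <;> ring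

theorem extD_contactForm {x : Fin 4 → ℝ} (hx : x ∈ offCore) (i j : Fin 4) :
    extD contactForm i j x = 2 * wedge (baseForm 0 x) (baseForm 1 x) i j := by
  have hr := (sq_add_sq_pos hx).ne'
  -- `contactForm` is the sum of `hopfForm` and the closed form `dθ`
  rw [← extD_hopfForm]
  have d : ∀ i j, partialD i (fun y => contactForm y j) x = partialD i (fun y => hopfForm y j) x
      + ![0, 0, -(((if i = 3 then 1 else 0) * (x 2 ^ 2 + x 3 ^ 2)
        - x 3 * (2 * x 2 * (if i = 2 then 1 else 0) + 2 * x 3 * (if i = 3 then 1 else 0)))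
          / (x 2 ^ 2 + x 3 ^ 2) ^ 2), ((if i = 2 then 1 else 0) * (x 2 ^ 2 + x 3 ^ 2)
        - x 2 * (2 * x 2 * (if i = 2 then 1 else 0) + 2 * x 3 * (if i = 3 then 1 else 0)))
          / (x 2 ^ 2 + x 3 ^ 2) ^ 2] j := by
    intro i j
    fin_cases j
    · exact (add_zero _).symm
    · exact (add_zero _).symm
    · exact ((partialD_neg _ x i).trans (congrArg Neg.neg (partialD_div_sq_add_sq hx 3 i))).trans
        ((zero_add _).symm.trans (congrArg (· + _) (partialD_const 0 x i).symm))
    · exact (partialD_div_sq_add_sq hx 2 i).trans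
        ((zero_add _).symm.trans (congrArg (· + _) (partialD_const 0 x i).symm))
  simp only [extD, d]
  fin_cases i <;> fin_cases j <;> simp <;> field_simp <;> ring

theorem partialD_baseForm (a : Fin 4) (x : Fin 4 → ℝ) (i j : Fin 4) :
    partialD i (fun y => baseForm a y j) x = -(2 * x 0 * (if i = 0 then 1 else 0)
      + 2 * x 1 * (if i = 1 then 1 else 0)) / baseDenom x ^ 2 * (Pi.single a 1 : Fin 4 → ℝ) j := by
  simp only [baseForm, Pi.smul_apply, smul_eq_mul]
  rw [partialD_mul (differentiable_baseDenom.differentiableAt.fun_inv (baseDenom_pos x).ne')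
    (by fun_prop), partialD_const, partialD_inv_baseDenom, mul_zero, add_zero]

theorem extD_baseForm_zero (x : Fin 4 → ℝ) (i j : Fin 4) :
    extD (baseForm 0) i j x = -(2 * wedge (hopfForm x) (baseForm 1 x) i j) := by
  have hb := (baseDenom_pos x).ne'
  simp only [extD, partialD_baseForm]
  simp only [wedge, hopfForm, baseForm]
  fin_cases i <;> fin_cases j <;> simp <;> field_simp

theorem extD_baseForm_one (x : Fin 4 → ℝ) (i j : Fin 4) :
    extD (baseForm 1) i j x = 2 * wedge (hopfForm x) (baseForm 0 x) i j := by
  have hb := (baseDenom_pos x).ne'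
  simp only [extD, partialD_baseForm]
  simp only [wedge, hopfForm, baseForm]
  fin_cases i <;> fin_cases j <;> simp <;> field_simp

theorem contDiffAt_radialForm {x : Fin 4 → ℝ} (hx : x ∈ offCore) (k : Fin 4) :
    ContDiffAt ℝ ∞ (fun y => radialForm y k) x := by
  have hn : ‖coordW x‖ ≠ 0 := (norm_pos_iff.2 hx).ne'
  fin_cases k
  · exact contDiffAt_const
  · exact contDiffAt_const
  · exact (contDiff_apply ℝ ℝ 2).contDiffAt.div (contDiffAt_norm_coordW hx) hn
  · exact (contDiff_apply ℝ ℝ 3).contDiffAt.div (contDiffAt_norm_coordW hx) hn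

theorem contDiffAt_contactForm {x : Fin 4 → ℝ} (hx : x ∈ offCore) (k : Fin 4) :
    ContDiffAt ℝ ∞ (fun y => contactForm y k) x := by
  have hr := (sq_add_sq_pos hx).ne'
  have hq : ContDiffAt ℝ ∞ (fun y : Fin 4 → ℝ => y 2 ^ 2 + y 3 ^ 2) x := by fun_prop
  fin_cases k
  · exact (contDiff_hopfForm 0).contDiffAt
  · exact (contDiff_hopfForm 1).contDiffAt
  · exact ((contDiff_apply ℝ ℝ 3).contDiffAt.div hq hr).neg
  · exact (contDiff_apply ℝ ℝ 2).contDiffAt.div hq hr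

theorem contDiff_baseForm (a k : Fin 4) : ContDiff ℝ ∞ fun x => baseForm a x k := by
  have hb : ContDiff ℝ ∞ baseDenom := by unfold baseDenom; fun_prop
  exact (hb.inv fun x => (baseDenom_pos x).ne').mul contDiff_const

/-! ### The curvature of the regular part -/

theorem extD_add {α γ : (Fin 4 → ℝ) → Fin 4 → ℝ} {x : Fin 4 → ℝ}
    (hα : ∀ k, DifferentiableAt ℝ (fun y => α y k) x)
    (hγ : ∀ k, DifferentiableAt ℝ (fun y => γ y k) x) (i j : Fin 4) :
    extD (fun y => α y + γ y) i j x = extD α i j x + extD γ i j x := by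
  simp only [extD, Pi.add_apply]
  rw [partialD_add (hα j) (hγ j), partialD_add (hα i) (hγ i)]
  ring

theorem curvatureMatrix_apply (Ω : Fin 4 → (Fin 4 → ℝ) → Matrix (Fin 4) (Fin 4) ℝ)
    (k j : Fin 4) (x : Fin 4 → ℝ) (a b : Fin 4) :
    curvatureMatrix Ω k j x a b = extD (fun y m => Ω m y a b) k j x
      + ∑ d, (Ω k x a d * Ω j x d b - Ω j x a d * Ω k x d b) := by
  simp only [curvatureMatrix, Matrix.add_apply, Matrix.sub_apply, Matrix.mul_apply, matD, extD,
    Matrix.of_apply, Finset.sum_sub_distrib]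

theorem curvatureMatrix_skew {Ω : Fin 4 → (Fin 4 → ℝ) → Matrix (Fin 4) (Fin 4) ℝ}
    (hskew : ∀ m y a b, Ω m y b a = -Ω m y a b) (k j : Fin 4) (x : Fin 4 → ℝ) (a b : Fin 4) :
    curvatureMatrix Ω k j x b a = -curvatureMatrix Ω k j x a b := by
  rw [curvatureMatrix_apply, curvatureMatrix_apply, neg_add, ← Finset.sum_neg_distrib]
  congr 1
  · simp only [extD]
    rw [show (fun y => Ω j y b a) = fun y => -Ω j y a b from funext fun y => hskew j y a b,
      show (fun y => Ω k y b a) = fun y => -Ω k y a b from funext fun y => hskew k y a b,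
      partialD_neg, partialD_neg]
    ring
  · refine Finset.sum_congr rfl fun d _ => ?_
    rw [hskew k x d b, hskew j x a d, hskew j x d b, hskew k x a d]
    ring

/-- The derivative of `f = - u v`; the profile equation expresses it without second derivatives. -/
noncomputable def fibreDeriv (c : ℝ) (u v : ℝ → ℝ) (r : ℝ) : ℝ :=
  v r ^ 2 - 2 + u r ^ 2 * (1 + c * v r ^ 2) / 2

/-- The Levi-Civita connection of the metric with orthonormal coframe `coframe u v`. Since
`f = - u v`, it takes values in `𝔲(2)`: the entries `(1, 2), (1, 3)` repeat the entries
`(0, 3), (0, 2)`. -/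
noncomputable def connectionForm (c : ℝ) (u v : ℝ → ℝ) (i : Fin 4) (x : Fin 4 → ℝ) :
    Matrix (Fin 4) (Fin 4) ℝ :=
  let p := fibreDeriv c u v ‖coordW x‖ * contactForm x i
  let q := v ‖coordW x‖ * baseForm 0 x i
  let s := v ‖coordW x‖ * baseForm 1 x i
  let t := 2 * hopfForm x i + -v ‖coordW x‖ ^ 2 * contactForm x i
  !![0, -p, -q, -s; p, 0, -s, q; q, s, 0, t; s, -q, -t, 0]

theorem connectionForm_skew (c : ℝ) (u v : ℝ → ℝ) (i : Fin 4) (x : Fin 4 → ℝ) (a b : Fin 4) :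
    connectionForm c u v i x b a = -connectionForm c u v i x a b := by
  fin_cases a <;> fin_cases b <;> simp [connectionForm]

namespace IsEvenProfile

theorem hasDerivAt_fibre {c β r : ℝ} {u v : ℝ → ℝ} (hp : IsEvenProfile c β u v)
    (hr : r ∈ Set.Ioo (-β) β) :
    HasDerivAt (fun r => -(u r * v r)) (fibreDeriv c u v r) r := by
  have e := profileAccel_mul (c := c) (v := v r) (hp.pos r hr).ne'
  refine ((hp.hasDerivAt r hr).fun_mul (hp.hasDerivAt_deriv r hr)).fun_neg.congr_deriv ?_
  rw [fibreDeriv, e]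
  ring

theorem hasDerivAt_fibreDeriv {c β r : ℝ} {u v : ℝ → ℝ} (hp : IsEvenProfile c β u v)
    (hr : r ∈ Set.Ioo (-β) β) :
    HasDerivAt (fibreDeriv c u v) (v r * (2 * profileAccel c (u r) (v r)
      + u r * (1 + c * v r ^ 2) + c * u r ^ 2 * profileAccel c (u r) (v r))) r := by
  have hu := hp.hasDerivAt r hr
  have hv := hp.hasDerivAt_deriv r hr
  refine (((hv.fun_pow 2).sub_const 2).fun_add (((hu.fun_pow 2).fun_mul
    (((hv.fun_pow 2).const_mul c).const_add 1)).div_const 2)).congr_deriv ?_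
  push_cast
  ring

variable {c β : ℝ} {u v : ℝ → ℝ} {x : Fin 4 → ℝ}

theorem norm_coordW_mem (hx : x ∈ chartDomain β) : ‖coordW x‖ ∈ Set.Ioo (-β) β :=
  ⟨by linarith [norm_nonneg (coordW x), show ‖coordW x‖ < β from hx], hx⟩

/-- The first structure equation. -/
theorem torsion (hp : IsEvenProfile c β u v) (hx : x ∈ offCore) (hxβ : x ∈ chartDomain β)
    (a i j : Fin 4) :
    (matD i (coframe u v) x + connectionForm c u v i x * coframe u v x) a j
      = (matD j (coframe u v) x + connectionForm c u v j x * coframe u v x) a i := by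
  have hr := norm_coordW_mem hxβ
  have dη := fun k => (contDiffAt_contactForm hx k).differentiableAt (by simp)
  have ds := fun a k => ((contDiff_baseForm a k).contDiffAt (x := x)).differentiableAt (by simp)
  have h0 : extD (fun y => coframe u v y 0) i j x = 0 := extD_radialForm hx i j
  have h1 : extD (fun y => coframe u v y 1) i j x = _ :=
    extD_radial_smul hx (hp.hasDerivAt_fibre hr) dη i j
  have h2 : extD (fun y => coframe u v y 2) i j x = _ :=
    extD_radial_smul hx (hp.hasDerivAt _ hr) (ds 0) i j
  have h3 : extD (fun y => coframe u v y 3) i j x = _ :=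
    extD_radial_smul hx (hp.hasDerivAt _ hr) (ds 1) i j
  rw [extD_contactForm hx] at h1
  rw [extD_baseForm_zero] at h2
  rw [extD_baseForm_one] at h3
  have key : extD (fun y => coframe u v y a) i j x
      + ∑ d, (connectionForm c u v i x a d * coframe u v x d j
        - connectionForm c u v j x a d * coframe u v x d i) = 0 := by
    fin_cases a
    · refine (congrArg (· + _) h0).trans ?_
      simp [Fin.sum_univ_four, connectionForm, coframe]
      ring
    · refine (congrArg (· + _) h1).trans ?_
      simp [Fin.sum_univ_four, connectionForm, coframe, wedge]
      ring
    · refine (congrArg (· + _) h2).trans ?_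
      simp [Fin.sum_univ_four, connectionForm, coframe, wedge]
      ring
    · refine (congrArg (· + _) h3).trans ?_
      simp [Fin.sum_univ_four, connectionForm, coframe, wedge]
      ring
  rw [Finset.sum_sub_distrib] at key
  simp only [Matrix.add_apply, Matrix.mul_apply, matD, Matrix.of_apply]
  simp only [extD] at key
  linarith

/-- The second structure equation: the curvature in terms of `q = u'' / u`. -/
theorem curvature (hp : IsEvenProfile c β u v) (hx : x ∈ offCore) (hxβ : x ∈ chartDomain β)
    {q : ℝ} (hq : profileAccel c (u ‖coordW x‖) (v ‖coordW x‖) = q * u ‖coordW x‖) (k j : Fin 4) :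
    (curvatureMatrix (connectionForm c u v) k j x 1 0
      = -(2 * q + (1 + c * v ‖coordW x‖ ^ 2) + c * u ‖coordW x‖ ^ 2 * q)
          * wedge (coframe u v x 0) (coframe u v x 1) k j
        + -2 * q * wedge (coframe u v x 2) (coframe u v x 3) k j) ∧
    (curvatureMatrix (connectionForm c u v) k j x 2 0
      = q * wedge (coframe u v x 0) (coframe u v x 2) k j
        + -q * wedge (coframe u v x 1) (coframe u v x 3) k j) ∧
    (curvatureMatrix (connectionForm c u v) k j x 3 0
      = q * wedge (coframe u v x 0) (coframe u v x 3) k j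
        + q * wedge (coframe u v x 1) (coframe u v x 2) k j) ∧
    (curvatureMatrix (connectionForm c u v) k j x 1 2
      = -q * wedge (coframe u v x 0) (coframe u v x 3) k j
        + -q * wedge (coframe u v x 1) (coframe u v x 2) k j) ∧
    (curvatureMatrix (connectionForm c u v) k j x 1 3
      = q * wedge (coframe u v x 0) (coframe u v x 2) k j
        + -q * wedge (coframe u v x 1) (coframe u v x 3) k j) ∧
    (curvatureMatrix (connectionForm c u v) k j x 2 3
      = 2 * q * wedge (coframe u v x 0) (coframe u v x 1) k j
        + (2 * q + (1 + c * v ‖coordW x‖ ^ 2))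
          * wedge (coframe u v x 2) (coframe u v x 3) k j) := by
  have hr := norm_coordW_mem hxβ
  have hu := (hp.pos _ hr).ne'
  have ode := profileAccel_mul (c := c) (v := v ‖coordW x‖) hu
  have dη := fun k => (contDiffAt_contactForm hx k).differentiableAt (by simp)
  have dA := fun k => ((contDiff_hopfForm k).contDiffAt (x := x)).differentiableAt (by simp)
  have ds := fun a k => ((contDiff_baseForm a k).contDiffAt (x := x)).differentiableAt (by simp)
  have hP := hp.hasDerivAt_fibreDeriv hr
  have hv := hp.hasDerivAt_deriv _ hr
  have hv' := (hv.fun_pow 2).fun_neg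
  have dnorm := (contDiffAt_norm_coordW hx).differentiableAt (by simp)
  have dv2 : DifferentiableAt ℝ (fun y => -v ‖coordW y‖ ^ 2) x :=
    DifferentiableAt.comp (g := fun r => -v r ^ 2) (f := fun y => ‖coordW y‖) x hv'.differentiableAt dnorm
  have h1 : extD (fun y => fibreDeriv c u v ‖coordW y‖ • contactForm y) k j x = _ :=
    extD_radial_smul hx hP dη k j
  have h2 : extD (fun y => v ‖coordW y‖ • baseForm 0 y) k j x = _ :=
    extD_radial_smul hx hv (ds 0) k j
  have h3 : extD (fun y => v ‖coordW y‖ • baseForm 1 y) k j x = _ :=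
    extD_radial_smul hx hv (ds 1) k j
  have h4 : extD (fun y => (2 : ℝ) • hopfForm y) k j x = _ :=
    extD_radial_smul hx (hasDerivAt_const _ (2 : ℝ)) dA k j
  have h5 : extD (fun y => -v ‖coordW y‖ ^ 2 • contactForm y) k j x = _ :=
    extD_radial_smul hx hv' dη k j
  have h6 : extD (fun y => (2 : ℝ) • hopfForm y + -v ‖coordW y‖ ^ 2 • contactForm y) k j x = _ :=
    extD_add (α := fun y => (2 : ℝ) • hopfForm y) (γ := fun y => -v ‖coordW y‖ ^ 2 • contactForm y)
      (fun k => (dA k).const_mul 2) (fun k => dv2.fun_mul (dη k)) k j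
  rw [h4, h5] at h6
  rw [hq] at ode
  have eP : fibreDeriv c u v ‖coordW x‖ = -v ‖coordW x‖ ^ 2 - q * u ‖coordW x‖ ^ 2 := by
    rw [fibreDeriv]; linear_combination ode
  rw [extD_contactForm hx, hq, eP] at h1
  rw [extD_baseForm_zero, hq] at h2
  rw [extD_baseForm_one, hq] at h3
  rw [extD_contactForm hx, extD_hopfForm, hq] at h6
  have e21 : curvatureMatrix (connectionForm c u v) k j x 2 1
      = q * wedge (coframe u v x 0) (coframe u v x 3) k j
        + q * wedge (coframe u v x 1) (coframe u v x 2) k j := by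
    rw [curvatureMatrix_apply]
    refine (congrArg (· + _) h3).trans ?_
    simp [Fin.sum_univ_four, connectionForm, coframe, wedge, eP]
    ring
  refine ⟨?_, ?_, ?_, ?_, ?_, ?_⟩
  · rw [curvatureMatrix_apply]
    refine (congrArg (· + _) h1).trans ?_
    simp [Fin.sum_univ_four, connectionForm, coframe, wedge]
    ring
  · rw [curvatureMatrix_apply]
    refine (congrArg (· + _) h2).trans ?_
    simp [Fin.sum_univ_four, connectionForm, coframe, wedge, eP]
    ring
  · rw [curvatureMatrix_apply]
    refine (congrArg (· + _) h3).trans ?_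
    simp [Fin.sum_univ_four, connectionForm, coframe, wedge, eP]
    ring
  · rw [curvatureMatrix_skew (connectionForm_skew c u v) k j x 2 1, e21]
    ring
  · rw [curvatureMatrix_apply]
    refine (congrArg (· + _) h2).trans ?_
    simp [Fin.sum_univ_four, connectionForm, coframe, wedge, eP]
    ring
  · rw [curvatureMatrix_apply]
    refine (congrArg (· + _) h6).trans ?_
    simp [Fin.sum_univ_four, connectionForm, coframe, wedge]
    linear_combination (-2 * (baseForm 0 x k * baseForm 1 x j - baseForm 0 x j * baseForm 1 x k))
      * ode

end IsEvenProfile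

/-! ### The Ricci tensor -/

theorem contDiffOn_comp_norm_coordW {β : ℝ} {φ : ℝ → ℝ} (hφ : ContDiffOn ℝ ∞ φ (Set.Ioo (-β) β)) :
    ContDiffOn ℝ ∞ (fun x => φ ‖coordW x‖) (offCore ∩ chartDomain β) := fun x hx =>
  (((hφ.contDiffAt (isOpen_Ioo.mem_nhds (IsEvenProfile.norm_coordW_mem hx.2))).comp x
    (contDiffAt_norm_coordW hx.1))).contDiffWithinAt

namespace IsEvenProfile

variable {c β : ℝ} {u v : ℝ → ℝ}

theorem contDiffOn_coframe (hp : IsEvenProfile c β u v) (a k : Fin 4) :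
    ContDiffOn ℝ ∞ (fun x => coframe u v x a k) (offCore ∩ chartDomain β) := by
  have hu := contDiffOn_comp_norm_coordW hp.contDiffOn.1
  have hv := contDiffOn_comp_norm_coordW hp.contDiffOn.2
  fin_cases a
  · exact fun x hx => (contDiffAt_radialForm hx.1 k).contDiffWithinAt
  · exact (hu.mul hv).neg.mul fun x hx => (contDiffAt_contactForm hx.1 k).contDiffWithinAt
  · exact hu.mul (contDiff_baseForm 0 k).contDiffOn
  · exact hu.mul (contDiff_baseForm 1 k).contDiffOn

theorem differentiableOn_connectionForm (hp : IsEvenProfile c β u v) (i a b : Fin 4) :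
    DifferentiableOn ℝ (fun x => connectionForm c u v i x a b) (offCore ∩ chartDomain β) := by
  have hv := (contDiffOn_comp_norm_coordW hp.contDiffOn.2).differentiableOn (by simp)
  have hη : DifferentiableOn ℝ (fun x => contactForm x i) (offCore ∩ chartDomain β) := fun x hx =>
    ((contDiffAt_contactForm hx.1 i).differentiableAt (by simp)).differentiableWithinAt
  have hA : DifferentiableOn ℝ (fun x => hopfForm x i) (offCore ∩ chartDomain β) :=
    ((contDiff_hopfForm i).differentiable (by simp)).differentiableOn
  have hs : ∀ a, DifferentiableOn ℝ (fun x => baseForm a x i) (offCore ∩ chartDomain β) := fun a =>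
    ((contDiff_baseForm a i).differentiable (by simp)).differentiableOn
  have hp' : DifferentiableOn ℝ (fun x => fibreDeriv c u v ‖coordW x‖ * contactForm x i)
      (offCore ∩ chartDomain β) := by
    have hP : ContDiffOn ℝ ∞ (fibreDeriv c u v) (Set.Ioo (-β) β) :=
      ((hp.contDiffOn.2.pow 2).sub contDiffOn_const).add (((hp.contDiffOn.1.pow 2).mul
        (contDiffOn_const.add (contDiffOn_const.mul (hp.contDiffOn.2.pow 2)))).div_const 2)
    exact ((contDiffOn_comp_norm_coordW hP).differentiableOn (by simp)).fun_mul hη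
  have hq := hv.fun_mul (hs 0)
  have hr := hv.fun_mul (hs 1)
  have ht := (hA.const_mul 2).fun_add ((hv.fun_pow 2).fun_neg.fun_mul hη)
  have h0 := differentiableOn_const (𝕜 := ℝ) (0 : ℝ) (s := offCore ∩ chartDomain β)
  fin_cases a <;> fin_cases b
  exacts [h0, hp'.fun_neg, hq.fun_neg, hr.fun_neg, hp', h0, hr.fun_neg, hq, hq, hr, h0, ht, hr,
    hq.fun_neg, ht.fun_neg, h0]

/-- The coframe diagonalizes the Ricci tensor, with two double eigenvalues. -/
theorem ricciMatrix_smoothMetric (hp : IsEvenProfile c β u v) (hβ : 0 < β) {x : Fin 4 → ℝ}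
    (hx : x ∈ offCore) (hxβ : x ∈ chartDomain β) (i j : Fin 4) :
    ricciMatrix (smoothMetric u v) x i j
      = (1 + c * (u ‖coordW x‖ * profileAccel c (u ‖coordW x‖) (v ‖coordW x‖) + v ‖coordW x‖ ^ 2))
          * (coframe u v x 0 i * coframe u v x 0 j + coframe u v x 1 i * coframe u v x 1 j)
        + (1 + c * v ‖coordW x‖ ^ 2)
          * (coframe u v x 2 i * coframe u v x 2 j + coframe u v x 3 i * coframe u v x 3 j) := by
  have hu := (hp.pos _ (norm_coordW_mem hxβ)).ne'
  obtain ⟨q, hq⟩ : ∃ q, profileAccel c (u ‖coordW x‖) (v ‖coordW x‖) = q * u ‖coordW x‖ :=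
    ⟨_, (div_mul_cancel₀ _ hu).symm⟩
  have hdet := det_coframe_ne_zero hp hx hxβ
  rw [ricciMatrix_eq_frame (isOpen_offCore.inter (isOpen_chartDomain β)) (smoothMetric_symm u v)
    (fun y hy => smoothMetric_eq_coframe hp hβ hy.1) hp.contDiffOn_coframe
    (fun y hy => det_coframe_ne_zero hp hy.1 hy.2) hp.differentiableOn_connectionForm
    (fun y _ m => by ext a b; simpa using connectionForm_skew c u v m y a b)
    (fun y hy => hp.torsion hy.1 hy.2) ⟨hx, hxβ⟩, hq]
  have hδ : ∀ a p, ∑ k, (coframe u v x)⁻¹ k a * coframe u v x p k = if p = a then 1 else 0 := by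
    intro a p
    have := congrFun (congrFun (Matrix.mul_nonsing_inv _ (isUnit_iff_ne_zero.2 hdet)) p) a
    rw [Matrix.mul_apply, Matrix.one_apply] at this
    rw [← this]
    exact Finset.sum_congr rfl fun k _ => mul_comm _ _
  set Θ := coframe u v x with hΘ
  set R := fun k => curvatureMatrix (connectionForm c u v) k j x with hR
  -- contraction of a curvature entry with a vector of the dual frame
  have ctr : ∀ (a p q r s : Fin 4) (A B : ℝ),
      ∑ k, Θ⁻¹ k a * (A * wedge (Θ p) (Θ q) k j + B * wedge (Θ r) (Θ s) k j)
        = A * ((if p = a then 1 else 0) * Θ q j - (if q = a then 1 else 0) * Θ p j)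
          + B * ((if r = a then 1 else 0) * Θ s j - (if s = a then 1 else 0) * Θ r j) := by
    intro a p q r s A B
    rw [← hδ a p, ← hδ a q, ← hδ a r, ← hδ a s]
    simp only [wedge, Fin.sum_univ_four]
    ring
  have skew : ∀ k a b, R k a b = -R k b a := fun k a b =>
    curvatureMatrix_skew (connectionForm_skew c u v) k j x b a
  have diag : ∀ k a, R k a a = 0 := fun k a => by linarith [skew k a a]
  have ent := hp.curvature hx hxβ hq
  have e10 := fun k => (ent k j).1
  have e20 := fun k => (ent k j).2.1
  have e30 := fun k => (ent k j).2.2.1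
  have e12 := fun k => (ent k j).2.2.2.1
  have e13 := fun k => (ent k j).2.2.2.2.1
  have e23 := fun k => (ent k j).2.2.2.2.2
  have con : ∀ (a b p q r s : Fin 4) (A B : ℝ),
      (∀ k, R k a b = A * wedge (Θ p) (Θ q) k j + B * wedge (Θ r) (Θ s) k j) →
      (∑ k, Θ⁻¹ k a * R k a b
        = A * ((if p = a then 1 else 0) * Θ q j - (if q = a then 1 else 0) * Θ p j)
          + B * ((if r = a then 1 else 0) * Θ s j - (if s = a then 1 else 0) * Θ r j)) ∧
      (∑ k, Θ⁻¹ k b * R k b a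
        = -(A * ((if p = b then 1 else 0) * Θ q j - (if q = b then 1 else 0) * Θ p j)
          + B * ((if r = b then 1 else 0) * Θ s j - (if s = b then 1 else 0) * Θ r j))) := by
    intro a b p q r s A B h
    refine ⟨?_, ?_⟩
    · simp only [h, ctr]
    · simp only [skew _ b a, h, mul_neg, Finset.sum_neg_distrib, ctr]
  have c10 := con _ _ _ _ _ _ _ _ e10
  have c20 := con _ _ _ _ _ _ _ _ e20
  have c30 := con _ _ _ _ _ _ _ _ e30
  have c12 := con _ _ _ _ _ _ _ _ e12
  have c13 := con _ _ _ _ _ _ _ _ e13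
  have c23 := con _ _ _ _ _ _ _ _ e23
  obtain ⟨S, hS⟩ : ∃ S : Fin 4 → Fin 4 → ℝ, ∀ a b, ∑ k, Θ⁻¹ k a * R k a b = S a b :=
    ⟨_, fun _ _ => rfl⟩
  have expand : ∑ k, (Θ⁻¹ * R k * Θ) k i
      = (S 0 0 + S 1 0 + S 2 0 + S 3 0) * Θ 0 i + (S 0 1 + S 1 1 + S 2 1 + S 3 1) * Θ 1 i
        + (S 0 2 + S 1 2 + S 2 2 + S 3 2) * Θ 2 i + (S 0 3 + S 1 3 + S 2 3 + S 3 3) * Θ 3 i := by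
    simp only [← hS, Matrix.mul_apply, Fin.sum_univ_four]
    ring
  have hdiag : ∀ a, S a a = 0 := fun a => by
    rw [← hS]
    exact Finset.sum_eq_zero fun k _ => by rw [diag, mul_zero]
  simp only [hS] at c10 c20 c30 c12 c13 c23
  rw [expand]
  simp only [hdiag, c10.1, c10.2, c20.1, c20.2, c30.1, c30.2, c12.1, c12.2, c13.1, c13.2,
    c23.1, c23.2]
  simp
  ring

theorem ricci_smoothMetric (hp : IsEvenProfile c β u v) (hβ : 0 < β) {x : Fin 4 → ℝ}
    (hx : x ∈ offCore) (hxβ : x ∈ chartDomain β) (a : Fin 4 → ℝ) :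
    ricci (smoothMetric u v) x a a
      = (1 + c * (u ‖coordW x‖ * profileAccel c (u ‖coordW x‖) (v ‖coordW x‖) + v ‖coordW x‖ ^ 2))
          * ((∑ k, radialForm x k * a k) ^ 2
            + (u ‖coordW x‖ * v ‖coordW x‖) ^ 2 * (∑ k, contactForm x k * a k) ^ 2)
        + (1 + c * v ‖coordW x‖ ^ 2)
          * (u ‖coordW x‖ ^ 2 * ((a 0 * a 0 + a 1 * a 1) / baseDenom x ^ 2)) := by
  have hb := (baseDenom_pos x).ne'
  simp only [ricci, hp.ricciMatrix_smoothMetric hβ hx hxβ, Fin.sum_univ_four]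
  simp [coframe, baseForm]
  field_simp
  ring

theorem sum_smoothMetric (hp : IsEvenProfile c β u v) (hβ : 0 < β) {x : Fin 4 → ℝ}
    (hx : x ∈ offCore) (a : Fin 4 → ℝ) :
    ∑ i, ∑ j, a i * smoothMetric u v x i j * a j
      = ((∑ k, radialForm x k * a k) ^ 2
          + (u ‖coordW x‖ * v ‖coordW x‖) ^ 2 * (∑ k, contactForm x k * a k) ^ 2)
        + u ‖coordW x‖ ^ 2 * ((a 0 * a 0 + a 1 * a 1) / baseDenom x ^ 2) := by
  have hb := (baseDenom_pos x).ne'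
  rw [smoothMetric_eq_coframe hp hβ hx]
  simp only [coframe_transpose_mul_apply, Fin.sum_univ_four]
  simp
  field_simp
  ring

end IsEvenProfile

/-! ### The Koiso–Cao metric -/

theorem chartLift_snd (β : ℝ) (i e : Fin 2) (x : Fin 4 → ℝ) :
    (chartLift β i e x).2 = orbitParam β e ‖coordW x‖ := by
  simp [chartLift, orbitParam]

/-- The factor `f u` does not see the orientation of the parameter `t`. -/
theorem profileF_sq_eq {β : ℝ} {h : ℝ → ℝ} {e : Fin 2} {r : ℝ} (hr : 0 < r) :
    profileF β h (orbitParam β e r) ^ 2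
      = (orbitProfile β h e r * orbitProfileDeriv β h e r) ^ 2 := by
  simp only [profileF, orbitProfile, orbitProfileDeriv, sign_pos hr, SignType.coe_one, one_mul]
  split_ifs <;> ring

theorem orbitProfileDeriv_sq {β : ℝ} {h : ℝ → ℝ} {e : Fin 2} {r : ℝ} (hr : 0 < r) :
    orbitProfileDeriv β h e r ^ 2 = derivWithin h (Set.Icc 0 β) (orbitParam β e r) ^ 2 := by
  simp only [orbitProfileDeriv, sign_pos hr, SignType.coe_one, one_mul]
  split_ifs <;> ring

namespace IsKoisoCaoProfile

variable {c β : ℝ} {h : ℝ → ℝ}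

theorem regularMetric_eq (hp : IsKoisoCaoProfile c β h) (i e : Fin 2) {x : Fin 4 → ℝ}
    (hx : x ∈ offCore) : regularMetric β h i e x
      = smoothMetric (orbitProfile β h e) (orbitProfileDeriv β h e) x := by
  obtain ⟨h1, h2, h3⟩ := fderiv_chartLift β i e hx
  rw [smoothMetric_eq_coframe (hp.isEvenProfile e) hp.beta_pos hx]
  ext k l
  rw [coframe_transpose_mul_apply, ← profileF_sq_eq (norm_pos_iff.2 hx)]
  simp only [regularMetric, cohomOneMetric, Matrix.of_apply, h3, h2, h1]
  rw [chartLift_snd, orbitProfile]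
  have hs : (if e = 0 then (1 : ℝ) else -1) * (if e = 0 then (1 : ℝ) else -1) = 1 := by
    split_ifs <;> norm_num
  have sum : ∀ (φ : Fin 4 → ℝ) k, ∑ m, φ m * (Pi.single k 1 : Fin 4 → ℝ) m = φ k := fun φ k => by
    simp [Pi.single_apply]
  rw [sum, sum, sum, sum, Pi.single_comm k 1 0, Pi.single_comm k 1 1, Pi.single_comm l 1 0,
    Pi.single_comm l 1 1]
  linear_combination (radialForm x k * radialForm x l) * hs

theorem koisoCaoMetric_eq (hp : IsKoisoCaoProfile c β h) (i e : Fin 2) {x : Fin 4 → ℝ}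
    (hx : x ∈ chartDomain β) : koisoCaoMetric β h i e x
      = smoothMetric (orbitProfile β h e) (orbitProfileDeriv β h e) x := by
  refine extendFrom_eq (mem_closure_offCore x) ?_
  have hc : Filter.Tendsto (smoothMetric (orbitProfile β h e) (orbitProfileDeriv β h e)) (𝓝 x)
      (𝓝 (smoothMetric (orbitProfile β h e) (orbitProfileDeriv β h e) x)) :=
    tendsto_pi_nhds.2 fun k => tendsto_pi_nhds.2 fun l =>
      ((contDiffOn_smoothMetric (hp.isEvenProfile e) k l).continuousOn.continuousAt
        ((isOpen_chartDomain β).mem_nhds hx)).tendsto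
  refine (hc.mono_left nhdsWithin_le_nhds).congr' ?_
  filter_upwards [self_mem_nhdsWithin] with y hy using (hp.regularMetric_eq i e hy).symm

theorem ricci_koisoCaoMetric_eq (hp : IsKoisoCaoProfile c β h) (i e : Fin 2) {x : Fin 4 → ℝ}
    (hx : x ∈ chartDomain β) (a : Fin 4 → ℝ) : ricci (koisoCaoMetric β h i e) x a a
      = ricci (smoothMetric (orbitProfile β h e) (orbitProfileDeriv β h e)) x a a :=
  ricci_congr (Filter.eventually_of_mem ((isOpen_chartDomain β).mem_nhds hx) fun _ hy =>
    hp.koisoCaoMetric_eq i e hy) a a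

theorem ricH_orbitParam (hp : IsKoisoCaoProfile c β h) (e : Fin 2) {r : ℝ}
    (hr : r ∈ Set.Ioo 0 β) : ricH c β h (orbitParam β e r)
      = 1 + c * (orbitProfile β h e r
        * profileAccel c (orbitProfile β h e r) (orbitProfileDeriv β h e r)
          + orbitProfileDeriv β h e r ^ 2) := by
  have ht := Set.Ioo_subset_Icc_self (orbitParam_mem_Ioo e hr)
  rw [ricH, hp.accel_eq ht]
  simp only [profileAccel, orbitProfileDeriv_sq hr.1, orbitProfile]

theorem ricY_orbitParam (e : Fin 2) {r : ℝ} (hr : 0 < r) :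
    ricY c β h (orbitParam β e r) = 1 + c * orbitProfileDeriv β h e r ^ 2 := by
  rw [ricY, orbitProfileDeriv_sq hr]

/-- `Ric = (ricH) (dt² + f² σ_X²) + (ricY) h² (σ_Y² + σ_Z²)` on the regular part. -/
theorem ricci_koisoCaoMetric (hp : IsKoisoCaoProfile c β h) (i e : Fin 2) {x : Fin 4 → ℝ}
    (hx : x ∈ offCore) (hxβ : x ∈ chartDomain β) (a : Fin 4 → ℝ) :
    ricci (koisoCaoMetric β h i e) x a a
      = ricH c β h (chartLift β i e x).2 * ((fderiv ℝ (chartLift β i e) x a).2 ^ 2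
          + profileF β h (chartLift β i e x).2 ^ 2
            * realInner (fieldX (chartLift β i e x).1) (fderiv ℝ (chartLift β i e) x a).1 ^ 2)
        + ricY c β h (chartLift β i e x).2 * (h (chartLift β i e x).2 ^ 2
          * (realInner (fieldY (chartLift β i e x).1) (fderiv ℝ (chartLift β i e) x a).1 ^ 2
            + realInner (fieldZ (chartLift β i e x).1) (fderiv ℝ (chartLift β i e) x a).1 ^ 2)) := by
  obtain ⟨h1, h2, h3⟩ := fderiv_chartLift β i e hx
  have hn : 0 < ‖coordW x‖ := norm_pos_iff.2 hx
  have hs : (if e = 0 then (1 : ℝ) else -1) ^ 2 = 1 := by split_ifs <;> norm_num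
  have h3' := h3 a a
  rw [← sq, ← sq] at h3'
  rw [h3', h2, h1, mul_pow, hs, one_mul, chartLift_snd, hp.ricH_orbitParam e ⟨hn, hxβ⟩,
    ricY_orbitParam e hn, profileF_sq_eq hn, hp.ricci_koisoCaoMetric_eq i e hxβ,
    (hp.isEvenProfile e).ricci_smoothMetric hp.beta_pos hx hxβ]
  rfl

/-- `Ric ≥ (1 + c) g`: by the bounds on the eigenvalues on the regular part, and by continuity on
the singular orbits. -/
theorem one_add_mul_le_ricci (hp : IsKoisoCaoProfile c β h) (e : Fin 2) {x : Fin 4 → ℝ}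
    (hxβ : x ∈ chartDomain β) (a : Fin 4 → ℝ) :
    (1 + c) * ∑ i, ∑ j, a i * smoothMetric (orbitProfile β h e) (orbitProfileDeriv β h e) x i j
      * a j ≤ ricci (smoothMetric (orbitProfile β h e) (orbitProfileDeriv β h e)) x a a := by
  have hE := hp.isEvenProfile e
  have hβ := hp.beta_pos
  have nb := (isOpen_chartDomain β).mem_nhds hxβ
  have hG := contDiffOn_smoothMetric hE
  have hdet : ∀ y ∈ chartDomain β,
      (smoothMetric (orbitProfile β h e) (orbitProfileDeriv β h e) y).det ≠ 0 := fun y hy =>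
    (posDef_smoothMetric hE hβ hy).det_pos.ne'
  have c1 : ContinuousOn (fun y => (1 + c) * ∑ i, ∑ j, a i *
      smoothMetric (orbitProfile β h e) (orbitProfileDeriv β h e) y i j * a j) (chartDomain β) :=
    continuousOn_const.mul (continuousOn_finsetSum _ fun i _ => continuousOn_finsetSum _ fun j _ =>
      (continuousOn_const.mul (hG i j).continuousOn).mul continuousOn_const)
  have c2 := continuousOn_ricci (isOpen_chartDomain β) hG hdet a a
  have : (𝓝[offCore] x).NeBot := mem_closure_iff_nhdsWithin_neBot.1 (mem_closure_offCore x)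
  refine le_of_tendsto_of_tendsto ((c1.continuousAt nb).tendsto.mono_left
    (nhdsWithin_le_nhds (s := offCore)))
    ((c2.continuousAt nb).tendsto.mono_left nhdsWithin_le_nhds) ?_
  filter_upwards [self_mem_nhdsWithin, mem_nhdsWithin_of_mem_nhds nb] with y hy hyβ
  have hn : 0 < ‖coordW y‖ := norm_pos_iff.2 hy
  have ht := Set.Ioo_subset_Icc_self (orbitParam_mem_Ioo e ⟨hn, show ‖coordW y‖ < β from hyβ⟩)
  have b1 := hp.one_add_le_ricH ht
  have b2 := hp.one_add_le_ricY ht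
  rw [hE.ricci_smoothMetric hβ hy hyβ, hE.sum_smoothMetric hβ hy, mul_add,
    ← hp.ricH_orbitParam e ⟨hn, hyβ⟩, ← ricY_orbitParam e hn]
  have p2 : 0 ≤ (a 0 * a 0 + a 1 * a 1) / baseDenom y ^ 2 :=
    div_nonneg (add_nonneg (mul_self_nonneg _) (mul_self_nonneg _)) (sq_nonneg _)
  exact add_le_add (mul_le_mul_of_nonneg_right b1 (by positivity))
    (mul_le_mul_of_nonneg_right b2 (mul_nonneg (sq_nonneg _) p2))

theorem ricci_koisoCaoMetric_pos (hp : IsKoisoCaoProfile c β h) (i e : Fin 2) {x : Fin 4 → ℝ}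
    (hxβ : x ∈ chartDomain β) {a : Fin 4 → ℝ} (ha : a ≠ 0) :
    0 < ricci (koisoCaoMetric β h i e) x a a := by
  rw [hp.ricci_koisoCaoMetric_eq i e hxβ]
  refine lt_of_lt_of_le (mul_pos (by linarith [hp.neg_one_lt_const]) ?_)
    (hp.one_add_mul_le_ricci e hxβ a)
  have := (posDef_smoothMetric (hp.isEvenProfile e) hp.beta_pos hxβ).dotProduct_mulVec_pos ha
  simpa [dotProduct, Matrix.mulVec, Finset.mul_sum, mul_assoc] using this

end IsKoisoCaoProfile

/-- At points of `S³` the fields `X, Y, Z` are orthonormal for `realInner`. -/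
theorem realInner_field {v : Fin 2 → ℂ} (hv : v ∈ S3) :
    (realInner (fieldX v) (fieldX v) = 1 ∧ realInner (fieldX v) (fieldY v) = 0 ∧
      realInner (fieldX v) (fieldZ v) = 0) ∧
    (realInner (fieldY v) (fieldX v) = 0 ∧ realInner (fieldY v) (fieldY v) = 1 ∧
      realInner (fieldY v) (fieldZ v) = 0) ∧
    (realInner (fieldZ v) (fieldX v) = 0 ∧ realInner (fieldZ v) (fieldY v) = 0 ∧
      realInner (fieldZ v) (fieldZ v) = 1) := by
  have hv' : (v 0).re * (v 0).re + (v 0).im * (v 0).im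
      + ((v 1).re * (v 1).re + (v 1).im * (v 1).im) = 1 := hv
  refine ⟨⟨?_, ?_, ?_⟩, ⟨?_, ?_, ?_⟩, ⟨?_, ?_, ?_⟩⟩ <;>
    simp [realInner, fieldX, fieldY, fieldZ] <;> linarith

theorem realInner_smul (u v : Fin 2 → ℂ) (r : ℝ) : realInner u (r • v) = r * realInner u v := by
  simp [realInner]
  ring

theorem realInner_zero (u : Fin 2 → ℂ) : realInner u 0 = 0 := by simp [realInner]

theorem proposition3p1 (c β : ℝ) (h : ℝ → ℝ) (hprof : IsKoisoCaoProfile c β h) :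
    -- the coordinate matrices are those of a smooth Riemannian metric
    (∀ i e : Fin 2,
      (∀ k l : Fin 4, ContDiffOn ℝ ∞ (fun x => koisoCaoMetric β h i e x k l) (chartDomain β)) ∧
      ∀ x ∈ chartDomain β, (koisoCaoMetric β h i e x).PosDef) ∧
    -- its Ricci curvature is positive at every point of the compact manifold
    (∀ p : BlowUpCP2, ∀ i e : Fin 2, ∀ x ∈ chartDomain β, chartParam β i e x = p →
      ∀ a : Fin 4 → ℝ, a ≠ 0 → 0 < ricci (koisoCaoMetric β h i e) x a a) ∧
    -- the Ricci curvature of the orthonormal frame `H, X/f, Y/h, Z/h` on the regular part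
    (∀ i e : Fin 2, ∀ x ∈ chartDomain β, x ∈ offCore →
      ∀ (v : Fin 2 → ℂ) (t : ℝ), chartLift β i e x = (v, t) → ∀ a : Fin 4 → ℝ,
        (fderiv ℝ (chartLift β i e) x a = (0, 1) →
          ricci (koisoCaoMetric β h i e) x a a = ricH c β h t) ∧
        (fderiv ℝ (chartLift β i e) x a = ((profileF β h t)⁻¹ • fieldX v, 0) →
          ricci (koisoCaoMetric β h i e) x a a = ricH c β h t) ∧
        (fderiv ℝ (chartLift β i e) x a = ((h t)⁻¹ • fieldY v, 0) →
          ricci (koisoCaoMetric β h i e) x a a = ricY c β h t) ∧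
        (fderiv ℝ (chartLift β i e) x a = ((h t)⁻¹ • fieldZ v, 0) →
          ricci (koisoCaoMetric β h i e) x a a = ricY c β h t)) ∧
    -- and both functions are positive on `[0, β]`
    (∀ t ∈ Set.Icc 0 β, 0 < ricH c β h t ∧ 0 < ricY c β h t) := by
  have hc := hprof.neg_one_lt_const
  refine ⟨fun i e => ⟨fun k l => ?_, fun x hx => ?_⟩, fun p i e x hx _ a ha =>
    hprof.ricci_koisoCaoMetric_pos i e hx ha, fun i e x hxβ hx v t hvt a => ?_, fun t ht =>
    ⟨by linarith [hprof.one_add_le_ricH ht], by linarith [hprof.one_add_le_ricY ht]⟩⟩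
  · exact (contDiffOn_smoothMetric (hprof.isEvenProfile e) k l).congr fun x hx => by
      rw [hprof.koisoCaoMetric_eq i e hx]
  · rw [hprof.koisoCaoMetric_eq i e hx]
    exact posDef_smoothMetric (hprof.isEvenProfile e) hprof.beta_pos hx
  · have hv : v ∈ S3 := by
      have := chartLift_mem β i e x
      rwa [hvt] at this
    have ht : t ∈ Set.Ioo 0 β := by
      have := orbitParam_mem_Ioo (β := β) e ⟨norm_pos_iff.2 hx, hxβ⟩
      rwa [← chartLift_snd β i e, hvt] at this
    have hh := (hprof.pos t (Set.Ioo_subset_Icc_self ht)).ne'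
    have hf : profileF β h t ≠ 0 := neg_ne_zero.2 (mul_ne_zero hh (hprof.deriv_neg t ht).ne)
    obtain ⟨⟨xx, xy, xz⟩, ⟨yx, yy, yz⟩, ⟨zx, zy, zz⟩⟩ := realInner_field hv
    have ric := hprof.ricci_koisoCaoMetric i e hx hxβ a
    rw [hvt] at ric
    refine ⟨fun ha => ?_, fun ha => ?_, fun ha => ?_, fun ha => ?_⟩ <;> rw [ric, ha] <;>
      simp only [realInner_zero, realInner_smul, xx, xy, xz, yx, yy, yz, zx, zy, zz] <;>
      field_simp <;> ring
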